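/- There is an absolute constant $C>0$ such that the following holds. Let $m\ge n\ge 1$ be integers, let $D=(p_1,\dots,p_n)$ be a probability distribution on $n$ outcomes such that every $mp_i$ is an integer (the condition $n\le m$ holds automatically when all $p_i>0$), and let $0<\varepsilon\le 1/2$. Then there is an algorithm, namely a program for a coin-tossing random access machine with logarithmic (bit) cost, that runs forever, uses independent fair coin tosses as its only source of randomness, and outputs an infinite sequence of independent samples whose law is exactly $D$, such that: 1. it uses at most $H(D)+\varepsilon$ coin tosses per sample, where $H(D)=-\sum_i p_i\log_2 p_i$; that is, $\limsup_{T\to\infty}\frac1T\,\mathbb E[\text{number of tosses until the $T$-th output}]\le H(D)+\varepsilon$; 2. at every moment of every run, the memory in use (the size of the program in bits plus the total number of bits of the contents and addresses of all nonzero registers) is at most $C\,(n+1/\varepsilon)\log(m/\varepsilon)$; 3. it makes $O(\log(m/\varepsilon)^2/\varepsilon)$ operations per sample; that is, $\limsup_{T\to\infty}\frac1T\,\mathbb E[\text{number of bit operations until the $T$-th output}]\le C\,\log(m/\varepsilon)^2/\varepsilon$. Here, up to a constant factor, each machine instruction is charged with the number of bits of its address in the program and of all numbers and register addresses it handles; multiplication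 and division of an $a$-bit by a $b$-bit number are charged with additional $ab$ operations (schoolbook method). -/

import Mathlib

open MeasureTheory Filter
open scoped ENNReal

/-!  A random access machine that tosses coins, with the logarithmic (bit) cost criterion.
Every register holds a natural number of any size.  What is charged, for time and for space, is
the number of bits of the numbers and of the addresses involved, where `Nat.size x` is the number
of binary digits of `x` (and `Nat.size 0 = 0`).  Multiplication and division are charged as the
schoolbook methods. -/

namespace CoinRAM

/-- The arithmetic operations of the machine. -/
inductive Op
  | add
  | sub
  | mul
  | div
  | mod

/-- The result of an operation (subtraction is truncated at `0`, `x / 0 = 0`, `x mod 0 = x`). -/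
def Op.eval : Op → ℕ → ℕ → ℕ
  | .add, x, y => x + y
  | .sub, x, y => x - y
  | .mul, x, y => x * y
  | .div, x, y => x / y
  | .mod, x, y => x % y

/-- Bit operations of an arithmetic operation: linear for addition and subtraction, quadratic
(schoolbook) for multiplication and division. -/
def Op.cost : Op → ℕ → ℕ → ℕ
  | .add, x, y => x.size + y.size
  | .sub, x, y => x.size + y.size
  | .mul, x, y => x.size + y.size + x.size * y.size
  | .div, x, y => x.size + y.size + x.size * y.size
  | .mod, x, y => x.size + y.size + x.size * y.size

/-- The instructions.  Write `R[i]` for the content of register `i`.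
* `const d c` : `R[d] := c`
* `arith o d a b` : `R[d] := R[a] o R[b]`
* `load d a` : `R[d] := R[R[a]]`
* `store a s` : `R[R[a]] := R[s]`
* `jle a b t` : if `R[a] ≤ R[b]`, go to instruction `t`
* `toss d` : toss a fresh coin and write the result, `0` or `1`, to `R[d]`
* `out a` : output `R[a]` -/
inductive Instr
  | const (d c : ℕ)
  | arith (o : Op) (d a b : ℕ)
  | load (d a : ℕ)
  | store (a s : ℕ)
  | jle (a b t : ℕ)
  | toss (d : ℕ)
  | out (a : ℕ)

/-- Number of bits that it takes to write an instruction down, up to a constant factor. -/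
def Instr.bits : Instr → ℕ
  | .const d c => 1 + d.size + c.size
  | .arith _ d a b => 1 + d.size + a.size + b.size
  | .load d a => 1 + d.size + a.size
  | .store a s => 1 + a.size + s.size
  | .jle a b t => 1 + a.size + b.size + t.size
  | .toss d => 1 + d.size
  | .out a => 1 + a.size

/-- Number of bit operations that an instruction takes when the registers hold `R`. -/
def Instr.cost (R : ℕ →₀ ℕ) : Instr → ℕ
  | .const d c => d.size + c.size
  | .arith o d a b => d.size + a.size + b.size + o.cost (R a) (R b)
  | .load d a => d.size + a.size + (R a).size + (R (R a)).size
  | .store a s => a.size + (R a).size + s.size + (R s).size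
  | .jle a b t => a.size + (R a).size + b.size + (R b).size + t.size
  | .toss d => d.size
  | .out a => a.size + (R a).size

/-- A program is a finite list of instructions, numbered from `0`. -/
abbrev Program := List Instr

/-- Number of bits that it takes to store a program, up to a constant factor. -/
def Program.bits (P : Program) : ℕ := (P.map Instr.bits).sum

/-- A state of the machine, together with what has happened so far. -/
structure Config where
  /-- number of the next instruction -/
  pc : ℕ
  /-- contents of the registers, all but finitely many of which are `0` -/
  reg : ℕ →₀ ℕ
  /-- number of coins tossed so far -/
  tosses : ℕ
  /-- number of bit operations made so far -/
  ops : ℕ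
  /-- everything that has been output so far, in order of output -/
  outputs : List ℕ

/-- The initial state: all registers are `0` and nothing has happened. -/
def Config.init : Config := ⟨0, 0, 0, 0, []⟩

/-- Number of bits held in the registers: every nonzero register counts with its content and with
its address. -/
def Config.dataBits (c : Config) : ℕ := ∑ i ∈ c.reg.support, (i.size + (c.reg i).size)

/-- The effect of an instruction, apart from its cost, when the `i`-th toss results in `ω i`. -/
noncomputable def Instr.exec (ω : ℕ → Bool) (c : Config) : Instr → Config
  | .const d x => { c with pc := c.pc + 1, reg := c.reg.update d x }
  | .arith o d a b =>
      { c with pc := c.pc + 1, reg := c.reg.update d (o.eval (c.reg a) (c.reg b)) }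
  | .load d a => { c with pc := c.pc + 1, reg := c.reg.update d (c.reg (c.reg a)) }
  | .store a s => { c with pc := c.pc + 1, reg := c.reg.update (c.reg a) (c.reg s) }
  | .jle a b t => { c with pc := if c.reg a ≤ c.reg b then t else c.pc + 1 }
  | .toss d =>
      { c with
        pc := c.pc + 1
        reg := c.reg.update d (ω c.tosses).toNat
        tosses := c.tosses + 1 }
  | .out a => { c with pc := c.pc + 1, outputs := c.outputs ++ [c.reg a] }

/-- One step of the machine.  It is charged with `1`, the bits of the program counter, and the cost
of the instruction.  If there is no instruction with the number `pc`, the machine has halted. -/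
noncomputable def step (P : Program) (ω : ℕ → Bool) (c : Config) : Config :=
  match P[c.pc]? with
  | none => c
  | some i => { i.exec ω c with ops := c.ops + (1 + c.pc.size + i.cost c.reg) }

/-- The state after `t` steps of the program `P` on the coin tosses `ω`. -/
noncomputable def run (P : Program) (ω : ℕ → Bool) (t : ℕ) : Config :=
  (step P ω)^[t] Config.init

/-- The law of an infinite sequence of independent fair coin tosses. -/
noncomputable def fairCoins : Measure (ℕ → Bool) :=
  Measure.infinitePi fun _ => (PMF.uniformOfFintype Bool).toMeasure

/-- The program outputs an infinite sequence of independent samples of the distribution `p`: for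
every `T`, the first `T` outputs are distributed as `T` independent samples.  (Summing over all
words `w` of length `T`, almost surely at least `T` outputs are made, each of them less
than `n`.) -/
def Samples {n : ℕ} (P : Program) (p : Fin n → ℝ) : Prop :=
  ∀ (T : ℕ) (w : Fin T → Fin n),
    fairCoins {ω | ∃ t, ∀ k : Fin T, (run P ω t).outputs[(k : ℕ)]? = some (w k : ℕ)} =
      ENNReal.ofReal (∏ k, p (w k))

/-- Number of coins tossed until the `T`-th output is made (`∞` if this never happens; the number
of tosses never decreases in the course of a run, so the infimum is that at the first moment
with `T` outputs). -/
noncomputable def tossesUntil (P : Program) (ω : ℕ → Bool) (T : ℕ) : ℝ≥0∞ :=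
  ⨅ (t : ℕ) (_ : T ≤ (run P ω t).outputs.length), ((run P ω t).tosses : ℝ≥0∞)

/-- Number of bit operations until the `T`-th output is made (`∞` if this never happens). -/
noncomputable def opsUntil (P : Program) (ω : ℕ → Bool) (T : ℕ) : ℝ≥0∞ :=
  ⨅ (t : ℕ) (_ : T ≤ (run P ω t).outputs.length), ((run P ω t).ops : ℝ≥0∞)

/-- The long-run expected number of coin tosses per sample. -/
noncomputable def tossRate (P : Program) : ℝ≥0∞ :=
  limsup (fun T : ℕ => (∫⁻ ω, tossesUntil P ω T ∂fairCoins) / (T : ℝ≥0∞)) atTop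

/-- The long-run expected number of bit operations per sample. -/
noncomputable def opRate (P : Program) : ℝ≥0∞ :=
  limsup (fun T : ℕ => (∫⁻ ω, opsUntil P ω T ∂fairCoins) / (T : ℝ≥0∞)) atTop

end CoinRAM

/-- Shannon entropy in bits. -/
noncomputable def entropyBits {n : ℕ} (p : Fin n → ℝ) : ℝ :=
  ∑ i, Real.negMulLog (p i) / Real.log 2

/-!
The sampler keeps a pair `Z < M` such that, given `M` and all previous outputs, `Z` is uniform on
`{0, …, M - 1}`. The weights `a i = m * p i` are natural numbers with sum `m`, and `cum a i` are
their partial sums.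

* As long as `M < 2 ^ K`, a coin `b` is tossed and `(Z, M)` becomes `(2 * Z + b, 2 * M)`.
* Otherwise let `q = M / m`. If `Z < q * m`, then `Z = s * m + cum a i + x` with `s < q` and
  `x < a i` for a single `i`, which is found by binary search in a table of the partial sums. It has
  the law `p`, it is the output, and given `i` the number `s * a i + x` is uniform on `q * a i`
  values, so that `(s * a i + x, q * a i)` is the next state: the randomness that the output does
  not use is recycled.
* If `Z ≥ q * m`, which has a probability of less than `m / 2 ^ K`, the state is reset to `(0, 1)`.

An output `i` lowers `logb 2 M` by `logb 2 (1 / p i)`, which is the entropy on average, and by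
`logb 2 (M / (q * m))`, which is small; a reset loses at most `K + 1` bits, rarely. With
`2 ^ K` about `(m / ε) ^ 2` the loss is at most `ε` per output (`smallLoss_of_le`). Hence `logb 2 M`
is a potential for the number of tosses (`cost_le`). All registers hold `O(log (m / ε))` bits, and a
round makes `O(log (m / ε) ^ 2)` bit operations, so the same lemma, with other costs of
a toss and of a division, bounds the number of bit operations.

The expectations are handled without a Markov chain on the states of the machine. For each `(Z, M)`
one takes the supremum, over all configurations at the start of the main loop with these values, of
the expected remaining cost (`expCost`), truncated so that it is finite. It satisfies one inequality
for each kind of round, and sums over `Z < M` turn these into inequalities in `M` alone. A toss is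
handled by the invariance of the coin measure under the reversal of a single coin
(`lintegral_coin`). The probabilities of the output words are treated in the same way, with an
infimum (`wordProb`, `prod_le_prob`). This gives lower bounds, which add up to `1` over all words of
a given length and are therefore equalities (`samples_of_le`).

The program is verified by the relation `Leads`: a deterministic stretch of a run, its cost, and a
bound on the registers at each of its steps.
-/

namespace CoinRAM

/-! ### Coin tosses -/

instance : IsProbabilityMeasure fairCoins := by
  unfold fairCoins; infer_instance

/-- The sequence of tosses `ω` with the `n`-th toss turned over. -/
def flipCoin (n : ℕ) (ω : ℕ → Bool) : ℕ → Bool := fun k => if k = n then !(ω k) else ω k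

lemma flipCoin_apply_self (n : ℕ) (ω : ℕ → Bool) : flipCoin n ω n = !(ω n) := by
  simp [flipCoin]

lemma flipCoin_apply_of_lt {n k : ℕ} (h : n < k) (ω : ℕ → Bool) : flipCoin n ω k = ω k := by
  simp [flipCoin, h.ne']

lemma measurePreserving_flipCoin (n : ℕ) :
    MeasurePreserving (flipCoin n) fairCoins fairCoins := by
  have h0 : ∀ k, Measurable (fun b : Bool => if k = n then !b else b) := fun k =>
    Measurable.of_discrete
  have hunif : (PMF.uniformOfFintype Bool).toMeasure.map (fun b : Bool => !b)
      = (PMF.uniformOfFintype Bool).toMeasure := by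
    rw [PMF.toMeasure_map (f := fun b : Bool => !b) _ Measurable.of_discrete]
    congr 1
    ext b
    rw [PMF.map_apply]
    cases b <;> simp [tsum_fintype]
  have hm : Measurable (flipCoin n) :=
    measurable_pi_lambda _ fun k => (h0 k).comp (measurable_pi_apply k)
  refine ⟨hm, ?_⟩
  have h := Measure.infinitePi_map_pi (μ := fun _ : ℕ => (PMF.uniformOfFintype Bool).toMeasure)
    (f := fun k (b : Bool) => if k = n then !b else b) h0
  unfold fairCoins
  refine Eq.trans h ?_
  congr 1
  funext k
  by_cases hk : k = n
  · simpa [hk] using hunif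
  · simp [hk]

/-- A toss whose result selects one of two quantities that do not depend on it contributes the
average of their expectations. -/
lemma lintegral_coin {n : ℕ} {g : Bool → (ℕ → Bool) → ℝ≥0∞} (hm : ∀ b, Measurable (g b))
    (hd : ∀ b ω, g b (flipCoin n ω) = g b ω) :
    ∫⁻ ω, g (ω n) ω ∂fairCoins =
      (∫⁻ ω, g false ω ∂fairCoins + ∫⁻ ω, g true ω ∂fairCoins) / 2 := by
  have hmeas : ∀ e : Bool → Bool, Measurable fun ω : ℕ → Bool => g (e (ω n)) ω := by
    intro e
    have : (fun ω : ℕ → Bool => g (e (ω n)) ω)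
        = fun ω => if ω n = true then g (e true) ω else g (e false) ω := by
      funext ω
      cases ω n <;> simp
    rw [this]
    have hs : MeasurableSet {ω : ℕ → Bool | ω n = true} :=
      (measurable_pi_apply n : Measurable fun ω : ℕ → Bool => ω n) (measurableSet_singleton true)
    exact Measurable.ite hs (hm _) (hm _)
  have h1 : ∫⁻ ω, g (ω n) ω ∂fairCoins = ∫⁻ ω, g (!(ω n)) ω ∂fairCoins := by
    refine ((measurePreserving_flipCoin n).lintegral_comp (hmeas id)).symm.trans ?_
    refine lintegral_congr fun ω => ?_
    rw [id, flipCoin_apply_self, hd]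
  have h2 : ∫⁻ ω, g (ω n) ω ∂fairCoins + ∫⁻ ω, g (ω n) ω ∂fairCoins
      = ∫⁻ ω, g false ω ∂fairCoins + ∫⁻ ω, g true ω ∂fairCoins := by
    conv_lhs => rw [h1]
    nth_rewrite 2 [← h1]
    rw [← lintegral_add_left (hmeas not), ← lintegral_add_left (hm false)]
    refine lintegral_congr fun ω => ?_
    cases ω n <;> simp [add_comm]
  rw [← h2, ← two_mul, mul_comm, ENNReal.mul_div_cancel_right (by simp) (by simp)]

/-! ### Dependence of runs on the tosses -/

lemma exec_congr {ω ω' : ℕ → Bool} {c : Config} (h : ω c.tosses = ω' c.tosses) (i : Instr) :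
    i.exec ω c = i.exec ω' c := by
  cases i <;> simp [Instr.exec, h]

lemma step_congr (P : Program) {ω ω' : ℕ → Bool} {c : Config} (h : ω c.tosses = ω' c.tosses) :
    step P ω c = step P ω' c := by
  unfold step
  cases P[c.pc]? with
  | none => rfl
  | some i => simp only [exec_congr h]

lemma tosses_le_step (P : Program) (ω : ℕ → Bool) (c : Config) :
    c.tosses ≤ (step P ω c).tosses ∧ (step P ω c).tosses ≤ c.tosses + 1 := by
  unfold step
  cases P[c.pc]? with
  | none => simp
  | some i => cases i <;> simp [Instr.exec]

lemma outputs_prefix_step (P : Program) (ω : ℕ → Bool) (c : Config) :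
    c.outputs <+: (step P ω c).outputs := by
  unfold step
  cases P[c.pc]? with
  | none => simp
  | some i => cases i <;> simp [Instr.exec]

lemma outputs_prefix_iterate (P : Program) (ω : ℕ → Bool) (c : Config) {s t : ℕ} (h : s ≤ t) :
    ((step P ω)^[s] c).outputs <+: ((step P ω)^[t] c).outputs := by
  induction t, h using Nat.le_induction with
  | base => exact List.prefix_rfl
  | succ t _ ih =>
    rw [Function.iterate_succ_apply']
    exact ih.trans (outputs_prefix_step P ω _)

/-- The first `t` steps read at most `t` tosses, beginning with the first one not yet read. -/
lemma iterate_step_congr (P : Program) {ω ω' : ℕ → Bool} (t : ℕ) (c : Config)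
    (h : ∀ k, c.tosses ≤ k → k < c.tosses + t → ω k = ω' k) :
    (step P ω)^[t] c = (step P ω')^[t] c := by
  induction t generalizing c with
  | zero => rfl
  | succ t ih =>
    rw [Function.iterate_succ_apply, Function.iterate_succ_apply,
      step_congr P (h c.tosses le_rfl (by omega))]
    have := tosses_le_step P ω' c
    exact ih _ fun k hk hk' => h k (by omega) (by omega)

lemma measurable_iterate_step {β : Type*} [MeasurableSpace β] (P : Program) (F : Config → β)
    (t : ℕ) (c : Config) : Measurable fun ω => F ((step P ω)^[t] c) := by
  let s := Finset.range (c.tosses + t)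
  let ext : (s → Bool) → ℕ → Bool := fun x k => if h : k ∈ s then x ⟨k, h⟩ else false
  have : (fun ω => F ((step P ω)^[t] c))
      = (fun x => F ((step P (ext x))^[t] c)) ∘ (fun (ω : ℕ → Bool) (k : s) => ω k) := by
    funext ω
    simp only [Function.comp]
    congr 1
    refine iterate_step_congr P t c fun k _ hk => ?_
    have : k ∈ s := Finset.mem_range.2 hk
    simp [ext, this]
  rw [this]
  exact Measurable.of_discrete.comp (measurable_pi_lambda _ fun k => measurable_pi_apply _)

/-! ### Cost until a given number of outputs -/

/-- The value of the counter `f` at the first moment with `T` outputs, in the run from `c` on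
(`∞` if there is no such moment). -/
noncomputable def costUntil (f : Config → ℕ) (P : Program) (T : ℕ) (c : Config) (ω : ℕ → Bool) :
    ℝ≥0∞ :=
  ⨅ (t : ℕ) (_ : T ≤ ((step P ω)^[t] c).outputs.length), (f ((step P ω)^[t] c) : ℝ≥0∞)

/-- The increase of the counter `f` until there are `T` outputs, truncated at `N` in order to be
finite. -/
noncomputable def restCost (N : ℕ) (f : Config → ℕ) (P : Program) (T : ℕ) (c : Config)
    (ω : ℕ → Bool) : ℝ≥0∞ :=
  min (costUntil f P T c ω - f c) N

section

variable (f : Config → ℕ) (P : Program) (T : ℕ)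

lemma measurable_costUntil (c : Config) : Measurable (costUntil f P T c) := by
  have h : ∀ t, Measurable fun ω : ℕ → Bool =>
      ⨅ (_ : T ≤ ((step P ω)^[t] c).outputs.length), (f ((step P ω)^[t] c) : ℝ≥0∞) :=
    fun t => measurable_iterate_step P
      (fun d : Config => ⨅ (_ : T ≤ d.outputs.length), (f d : ℝ≥0∞)) t c
  exact Measurable.iInf h

lemma measurable_restCost (N : ℕ) (c : Config) : Measurable (restCost N f P T c) :=
  ((measurable_costUntil f P T c).sub measurable_const).min measurable_const

lemma costUntil_congr (c : Config) {ω ω' : ℕ → Bool} (h : ∀ k, c.tosses ≤ k → ω k = ω' k) :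
    costUntil f P T c ω = costUntil f P T c ω' := by
  unfold costUntil
  refine iInf_congr fun t => ?_
  rw [iterate_step_congr P t c fun k hk _ => h k hk]

lemma costUntil_le_iterate (k : ℕ) (c : Config) (ω : ℕ → Bool) :
    costUntil f P T c ω ≤ costUntil f P T ((step P ω)^[k] c) ω := by
  refine le_iInf fun t => ?_
  rw [← Function.iterate_add_apply]
  exact iInf_le (fun t => ⨅ (_ : T ≤ ((step P ω)^[t] c).outputs.length),
    (f ((step P ω)^[t] c) : ℝ≥0∞)) (t + k)

variable {f P T} in
lemma costUntil_le_of_length_le {c : Config} (h : T ≤ c.outputs.length) (ω : ℕ → Bool) :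
    costUntil f P T c ω ≤ f c :=
  iInf₂_le_of_le 0 h le_rfl

variable {f P T} in
lemma restCost_eq_zero {N : ℕ} {c : Config} (h : T ≤ c.outputs.length) (ω : ℕ → Bool) :
    restCost N f P T c ω = 0 := by
  simp [restCost, tsub_eq_zero_of_le (costUntil_le_of_length_le h ω)]

variable {f P T} in
lemma restCost_le_add {N κ k : ℕ} {c c' : Config} {ω : ℕ → Bool}
    (h : (step P ω)^[k] c = c') (hf : f c' ≤ f c + κ) :
    restCost N f P T c ω ≤ κ + restCost N f P T c' ω := by
  unfold restCost
  have h1 : costUntil f P T c ω - f c ≤ κ + (costUntil f P T c' ω - f c') := by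
    rw [tsub_le_iff_right]
    calc costUntil f P T c ω ≤ costUntil f P T c' ω := h ▸ costUntil_le_iterate f P T k c ω
      _ ≤ (costUntil f P T c' ω - f c') + f c' := le_tsub_add
      _ ≤ (costUntil f P T c' ω - f c') + (f c + κ : ℕ) := by gcongr
      _ = κ + (costUntil f P T c' ω - f c') + f c := by push_cast; ring
  rcases le_total (costUntil f P T c' ω - f c') N with h2 | h2
  · rw [min_eq_left h2]
    exact (min_le_left _ _).trans h1
  · rw [min_eq_right h2]
    exact (min_le_right _ _).trans le_add_self

variable {f P T} in
/-- The rule of the expected cost for a single coin toss. -/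
lemma lintegral_restCost_toss {N κ : ℕ} {c : Config} {d : Bool → Config}
    (h : ∀ ω, step P ω c = d (ω c.tosses)) (hd : ∀ b, (d b).tosses = c.tosses + 1)
    (hf : ∀ b, f (d b) ≤ f c + κ) :
    ∫⁻ ω, restCost N f P T c ω ∂fairCoins ≤ κ + (∫⁻ ω, restCost N f P T (d false) ω ∂fairCoins
      + ∫⁻ ω, restCost N f P T (d true) ω ∂fairCoins) / 2 := by
  rw [← lintegral_coin (n := c.tosses) (g := fun b ω => restCost N f P T (d b) ω)
    (fun b => measurable_restCost f P T N _)]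
  · calc ∫⁻ ω, restCost N f P T c ω ∂fairCoins
        ≤ ∫⁻ ω, (κ + restCost N f P T (d (ω c.tosses)) ω) ∂fairCoins :=
          lintegral_mono fun ω => restCost_le_add (k := 1) (by simpa using h ω) (hf _)
      _ = _ := by rw [lintegral_add_left measurable_const]; simp
  · intro b ω
    unfold restCost
    rw [costUntil_congr f P T (d b)]
    intro k hk
    exact flipCoin_apply_of_lt (by rw [hd] at hk; omega) ω

end

/-! ### Probability of an output word -/

/-- The event that the run from `c` on outputs the word `w`, possibly followed by more. -/
def outputsWord (P : Program) (w : List ℕ) (c : Config) : Set (ℕ → Bool) :=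
  {ω | ∃ t, c.outputs ++ w <+: ((step P ω)^[t] c).outputs}

section

variable {P : Program} {w : List ℕ}

lemma outputsWord_nil (c : Config) : outputsWord P [] c = Set.univ :=
  Set.eq_univ_of_forall fun _ => ⟨0, by simp⟩

lemma measurableSet_outputsWord (c : Config) : MeasurableSet (outputsWord P w c) := by
  have : outputsWord P w c
      = ⋃ t, {ω | c.outputs ++ w <+: ((step P ω)^[t] c).outputs} := by
    ext ω; simp [outputsWord]
  rw [this]
  exact MeasurableSet.iUnion fun t => measurableSet_setOfPred.2
    (measurable_iterate_step P (fun d : Config => c.outputs ++ w <+: d.outputs) t c)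

lemma mem_outputsWord_congr (c : Config) {ω ω' : ℕ → Bool} (h : ∀ k, c.tosses ≤ k → ω k = ω' k) :
    ω ∈ outputsWord P w c ↔ ω' ∈ outputsWord P w c := by
  refine exists_congr fun t => ?_
  rw [iterate_step_congr P t c fun k hk _ => h k hk]

lemma mem_outputsWord_of_iterate {k : ℕ} {c c' : Config} {v : List ℕ} {ω : ℕ → Bool}
    (h : (step P ω)^[k] c = c') (ho : c'.outputs = c.outputs ++ v)
    (hω : ω ∈ outputsWord P w c') : ω ∈ outputsWord P (v ++ w) c := by
  obtain ⟨t, ht⟩ := hω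
  refine ⟨t + k, ?_⟩
  rw [Function.iterate_add_apply, h]
  simpa [ho] using ht

/-- The rule of the probability of an output word for a single coin toss. -/
lemma measure_outputsWord_toss {c : Config} {d : Bool → Config}
    (h : ∀ ω, step P ω c = d (ω c.tosses)) (hd : ∀ b, (d b).tosses = c.tosses + 1)
    (ho : ∀ b, (d b).outputs = c.outputs) :
    (fairCoins (outputsWord P w (d false)) + fairCoins (outputsWord P w (d true))) / 2 ≤
      fairCoins (outputsWord P w c) := by
  have key := lintegral_coin (n := c.tosses)
    (g := fun b => (outputsWord P w (d b)).indicator 1)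
    (fun b => measurable_one.indicator (measurableSet_outputsWord _)) (by
      intro b ω
      have : flipCoin c.tosses ω ∈ outputsWord P w (d b) ↔ ω ∈ outputsWord P w (d b) :=
        mem_outputsWord_congr _ fun k hk =>
          flipCoin_apply_of_lt (by rw [hd] at hk; omega) ω
      by_cases hw : ω ∈ outputsWord P w (d b)
      · simp [hw, this.2 hw]
      · simp [hw, this.not.2 hw])
  rw [lintegral_indicator_one (measurableSet_outputsWord _),
    lintegral_indicator_one (measurableSet_outputsWord _)] at key
  rw [← key, ← lintegral_indicator_one (measurableSet_outputsWord _)]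
  refine lintegral_mono fun ω => ?_
  by_cases hω : ω ∈ outputsWord P w (d (ω c.tosses))
  · have : ω ∈ outputsWord P w c := by
      simpa using mem_outputsWord_of_iterate (k := 1) (v := []) (h ω) (by simp [ho]) hω
    simp [hω, this]
  · simp [hω]

end

/-! ### Deterministic stretches of a run -/

/-- All registers hold at most `B`, and only the 16 working registers and the `N` registers after
them are in use. -/
def Safe (N B : ℕ) (r : ℕ →₀ ℕ) : Prop := ∀ i, r i ≤ B ∧ (16 + N ≤ i → r i = 0)

/-- From instruction `pc` with registers `r` and outputs `o`, the machine reaches after at least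
one step, without tossing a coin, a state with the property `Q`. On the way the registers are
`Safe`, and the number of bit operations is at most that of `x` cheap instructions (of linear cost)
and `y` expensive ones (of quadratic cost). -/
def Leads (P : Program) (N B x y pc : ℕ) (r : ℕ →₀ ℕ) (o : List ℕ)
    (Q : ℕ → (ℕ →₀ ℕ) → List ℕ → Prop) : Prop :=
  ∃ k pc' r' o' κ, 0 < k ∧ κ ≤ x * (40 + 4 * B.size) + y * (40 + 4 * B.size + B.size * B.size) ∧
    Q pc' r' o' ∧ ∀ ω τ u,
      (∀ j < k, Safe N B ((step P ω)^[j] ⟨pc, r, τ, u, o⟩).reg) ∧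
      (step P ω)^[k] ⟨pc, r, τ, u, o⟩ = ⟨pc', r', τ, u + κ, o'⟩

section

variable {P : Program} {N B x y x' y' pc : ℕ} {r : ℕ →₀ ℕ} {o : List ℕ}
  {Q R : ℕ → (ℕ →₀ ℕ) → List ℕ → Prop}

lemma Safe.update {d v : ℕ} (hs : Safe N B r) (hd : d < 16 + N) (hv : v ≤ B) :
    Safe N B (r.update d v) := by
  intro i
  rw [Finsupp.coe_update, Function.update_apply]
  split_ifs with h
  · exact ⟨hv, fun hi => by omega⟩
  · exact hs i

lemma Leads.mono (h : Leads P N B x y pc r o Q) (hx : x ≤ x') (hy : y ≤ y')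
    (hQ : ∀ pc r o, Q pc r o → R pc r o) : Leads P N B x' y' pc r o R := by
  obtain ⟨k, pc', r', o', κ, hk, hκ, hq, h⟩ := h
  exact ⟨k, pc', r', o', κ, hk, hκ.trans (by gcongr), hQ _ _ _ hq, h⟩

lemma Leads.trans (h : Leads P N B x y pc r o Q)
    (h' : ∀ pc r o, Q pc r o → Leads P N B x' y' pc r o R) :
    Leads P N B (x + x') (y + y') pc r o R := by
  obtain ⟨k, pc₁, r₁, o₁, κ, hk, hκ, hq, h⟩ := h
  obtain ⟨k', pc₂, r₂, o₂, κ', hk', hκ', hq', h'⟩ := h' _ _ _ hq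
  refine ⟨k' + k, pc₂, r₂, o₂, κ + κ', by omega, by linarith, hq', fun ω τ u => ⟨?_, ?_⟩⟩
  · intro j hj
    by_cases hjk : j < k
    · exact (h ω τ u).1 j hjk
    · obtain ⟨i, rfl⟩ := Nat.exists_eq_add_of_le' (not_lt.1 hjk)
      rw [Function.iterate_add_apply, (h ω τ u).2]
      exact (h' ω τ _).1 i (by omega)
  · rw [Function.iterate_add_apply, (h ω τ u).2, (h' ω τ _).2, add_assoc]

/-- A single instruction that does not toss a coin. -/
lemma leads_one {i : Instr} {pc' : ℕ} {r' : ℕ →₀ ℕ} {o' : List ℕ} (hP : P[pc]? = some i)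
    (hs : Safe N B r)
    (hκ : 1 + pc.size + i.cost r ≤
      x * (40 + 4 * B.size) + y * (40 + 4 * B.size + B.size * B.size))
    (hex : ∀ ω τ u, i.exec ω ⟨pc, r, τ, u, o⟩ = ⟨pc', r', τ, u, o'⟩) (hQ : Q pc' r' o') :
    Leads P N B x y pc r o Q := by
  refine ⟨1, pc', r', o', _, one_pos, hκ, hQ, fun ω τ u => ⟨?_, ?_⟩⟩
  · intro j hj
    obtain rfl : j = 0 := by omega
    exact hs
  · simp [step, hP, hex]

/-- A single instruction of linear cost followed by more. -/
lemma leads_cheap {i : Instr} {r' : ℕ →₀ ℕ} {o' : List ℕ} {pc' : ℕ} (hP : P[pc]? = some i)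
    (hs : Safe N B r) (hκ : 1 + pc.size + i.cost r ≤ 40 + 4 * B.size)
    (hex : ∀ ω τ u, i.exec ω ⟨pc, r, τ, u, o⟩ = ⟨pc', r', τ, u, o'⟩)
    (next : Leads P N B x y pc' r' o' Q) : Leads P N B (x + 1) y pc r o Q := by
  have h : Leads P N B 1 0 pc r o (fun p s q => p = pc' ∧ s = r' ∧ q = o') :=
    leads_one hP hs (by omega) hex ⟨rfl, rfl, rfl⟩
  refine (h.trans (x' := x) (y' := y) ?_).mono (by omega) (by omega) fun _ _ _ => id
  rintro _ _ _ ⟨rfl, rfl, rfl⟩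
  exact next

lemma size_le_four {d : ℕ} (h : d < 16) : d.size ≤ 4 := Nat.size_le.2 (by simpa using h)

lemma size_le_six {d : ℕ} (h : d < 64) : d.size ≤ 6 := Nat.size_le.2 (by simpa using h)

lemma Safe.size_le (hs : Safe N B r) (i : ℕ) : (r i).size ≤ B.size := Nat.size_le_size (hs i).1

lemma leads_const {d v : ℕ} (hP : P[pc]? = some (.const d v)) (hpc : pc < 64) (hd : d < 16)
    (hv : v ≤ B) (hs : Safe N B r)
    (next : Safe N B (r.update d v) → Leads P N B x y (pc + 1) (r.update d v) o Q) :
    Leads P N B (x + 1) y pc r o Q := by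
  refine leads_cheap hP hs ?_ (fun _ _ _ => rfl) (next (hs.update (by omega) hv))
  have h1 := size_le_six hpc
  have h2 := size_le_four hd
  have h3 := Nat.size_le_size hv
  simp only [Instr.cost]
  omega

lemma leads_arith_last {op : Op} {d a b : ℕ} (v : ℕ) (hP : P[pc]? = some (.arith op d a b))
    (hpc : pc < 64) (hd : d < 16) (ha : a < 16) (hb : b < 16) (hv : op.eval (r a) (r b) = v)
    (hvB : v ≤ B) (hs : Safe N B r) (hQ : Safe N B (r.update d v) → Q (pc + 1) (r.update d v) o) :
    Leads P N B 0 1 pc r o Q := by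
  subst hv
  refine leads_one hP hs ?_ (fun _ _ _ => rfl) (hQ (hs.update (by omega) hvB))
  have h1 := size_le_six hpc
  have h2 := size_le_four hd
  have h3 := size_le_four ha
  have h4 := size_le_four hb
  have h5 := hs.size_le a
  have h6 := hs.size_le b
  have h7 : (r a).size * (r b).size ≤ B.size * B.size := Nat.mul_le_mul h5 h6
  cases op <;> simp only [Instr.cost, Op.cost] <;> omega

lemma leads_arith {op : Op} {d a b : ℕ} (v : ℕ) (hP : P[pc]? = some (.arith op d a b))
    (hpc : pc < 64) (hd : d < 16) (ha : a < 16) (hb : b < 16) (hv : op.eval (r a) (r b) = v)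
    (hvB : v ≤ B) (hs : Safe N B r)
    (next : Safe N B (r.update d v) → Leads P N B x y (pc + 1) (r.update d v) o Q) :
    Leads P N B x (y + 1) pc r o Q := by
  have h : Leads P N B 0 1 pc r o (fun p s q =>
      p = pc + 1 ∧ s = r.update d v ∧ q = o) :=
    leads_arith_last v hP hpc hd ha hb hv hvB hs fun _ => ⟨rfl, rfl, rfl⟩
  refine (h.trans (x' := x) (y' := y) ?_).mono (by omega) (by omega) fun _ _ _ => id
  rintro _ _ _ ⟨rfl, rfl, rfl⟩
  exact next (hs.update (by omega) hvB)

lemma leads_add {d a b : ℕ} (v : ℕ) (hP : P[pc]? = some (.arith .add d a b)) (hpc : pc < 64)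
    (hd : d < 16) (ha : a < 16) (hb : b < 16) (hv : r a + r b = v) (hvB : v ≤ B)
    (hs : Safe N B r)
    (next : Safe N B (r.update d v) → Leads P N B x y (pc + 1) (r.update d v) o Q) :
    Leads P N B (x + 1) y pc r o Q := by
  subst hv
  refine leads_cheap hP hs ?_ (fun _ _ _ => rfl) (next (hs.update (by omega) hvB))
  have h1 := size_le_six hpc
  have h2 := size_le_four hd
  have h3 := size_le_four ha
  have h4 := size_le_four hb
  have h5 := hs.size_le a
  have h6 := hs.size_le b
  simp only [Instr.cost, Op.cost]
  omega

lemma leads_sub {d a b : ℕ} (v : ℕ) (hP : P[pc]? = some (.arith .sub d a b)) (hpc : pc < 64)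
    (hd : d < 16) (ha : a < 16) (hb : b < 16) (hv : r a - r b = v) (hs : Safe N B r)
    (next : Safe N B (r.update d v) → Leads P N B x y (pc + 1) (r.update d v) o Q) :
    Leads P N B (x + 1) y pc r o Q := by
  subst hv
  refine leads_cheap hP hs ?_ (fun _ _ _ => rfl)
    (next (hs.update (by omega) ((Nat.sub_le _ _).trans (hs a).1)))
  have h1 := size_le_six hpc
  have h2 := size_le_four hd
  have h3 := size_le_four ha
  have h4 := size_le_four hb
  have h5 := hs.size_le a
  have h6 := hs.size_le b
  simp only [Instr.cost, Op.cost]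
  omega

/-- Halving has linear cost, because the divisor has two bits. -/
lemma leads_half {d a b : ℕ} (v : ℕ) (hP : P[pc]? = some (.arith .div d a b)) (hpc : pc < 64)
    (hd : d < 16) (ha : a < 16) (hb : b < 16) (h2 : r b = 2) (hv : r a / 2 = v)
    (hs : Safe N B r)
    (next : Safe N B (r.update d v) → Leads P N B x y (pc + 1) (r.update d v) o Q) :
    Leads P N B (x + 1) y pc r o Q := by
  subst hv
  refine leads_cheap hP hs ?_ (fun _ _ _ => by simp only [Instr.exec, Op.eval, h2])
    (next (hs.update (by omega) ((Nat.div_le_self _ _).trans (hs a).1)))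
  have h1 := size_le_six hpc
  have h2' := size_le_four hd
  have h3 := size_le_four ha
  have h4 := size_le_four hb
  have h5 := hs.size_le a
  have h6 : Nat.size 2 = 2 := by decide
  simp only [Instr.cost, Op.cost, h2, h6]
  omega

lemma leads_load {d a : ℕ} (v : ℕ) (hP : P[pc]? = some (.load d a)) (hpc : pc < 64)
    (hd : d < 16) (ha : a < 16) (hv : r (r a) = v) (hs : Safe N B r)
    (next : Safe N B (r.update d v) → Leads P N B x y (pc + 1) (r.update d v) o Q) :
    Leads P N B (x + 1) y pc r o Q := by
  subst hv
  refine leads_cheap hP hs ?_ (fun _ _ _ => rfl) (next (hs.update (by omega) (hs _).1))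
  have h1 := size_le_six hpc
  have h2 := size_le_four hd
  have h3 := size_le_four ha
  have h5 := hs.size_le a
  have h6 := hs.size_le (r a)
  simp only [Instr.cost]
  omega

lemma cost_jle_le {a b t : ℕ} (hpc : pc < 64) (ha : a < 16) (hb : b < 16) (ht : t < 64)
    (hs : Safe N B r) : 1 + pc.size + (Instr.jle a b t).cost r ≤ 40 + 4 * B.size := by
  have h1 := size_le_six hpc
  have h2 := size_le_six ht
  have h3 := size_le_four ha
  have h4 := size_le_four hb
  have h5 := hs.size_le a
  have h6 := hs.size_le b
  simp only [Instr.cost]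
  omega

lemma leads_jle {a b t : ℕ} (hP : P[pc]? = some (.jle a b t)) (hpc : pc < 64)
    (ha : a < 16) (hb : b < 16) (ht : t < 64) (h : r a ≤ r b) (hs : Safe N B r)
    (next : Leads P N B x y t r o Q) : Leads P N B (x + 1) y pc r o Q :=
  leads_cheap hP hs (cost_jle_le hpc ha hb ht hs) (fun _ _ _ => by simp [Instr.exec, h]) next

lemma leads_jle_of_lt {a b t : ℕ} (hP : P[pc]? = some (.jle a b t)) (hpc : pc < 64)
    (ha : a < 16) (hb : b < 16) (ht : t < 64) (h : r b < r a) (hs : Safe N B r)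
    (next : Leads P N B x y (pc + 1) r o Q) : Leads P N B (x + 1) y pc r o Q :=
  leads_cheap hP hs (cost_jle_le hpc ha hb ht hs)
    (fun _ _ _ => by simp [Instr.exec, h.not_ge]) next

lemma leads_jle_last {a b t : ℕ} (hP : P[pc]? = some (.jle a b t)) (hpc : pc < 64)
    (ha : a < 16) (hb : b < 16) (ht : t < 64) (h : r a ≤ r b) (hs : Safe N B r)
    (hQ : Q t r o) : Leads P N B 1 0 pc r o Q :=
  leads_one hP hs (by simpa using cost_jle_le hpc ha hb ht hs)
    (fun _ _ _ => by simp [Instr.exec, h]) hQ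

lemma leads_jle_last_of_lt {a b t : ℕ} (hP : P[pc]? = some (.jle a b t)) (hpc : pc < 64)
    (ha : a < 16) (hb : b < 16) (ht : t < 64) (h : r b < r a) (hs : Safe N B r)
    (hQ : Q (pc + 1) r o) : Leads P N B 1 0 pc r o Q :=
  leads_one hP hs (by simpa using cost_jle_le hpc ha hb ht hs)
    (fun _ _ _ => by simp [Instr.exec, h.not_ge]) hQ

lemma leads_out {a : ℕ} (v : ℕ) (hP : P[pc]? = some (.out a)) (hpc : pc < 64) (ha : a < 16)
    (hv : r a = v) (hs : Safe N B r) (next : Leads P N B x y (pc + 1) r (o ++ [v]) Q) :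
    Leads P N B (x + 1) y pc r o Q := by
  subst hv
  refine leads_cheap hP hs ?_ (fun _ _ _ => rfl) next
  have h1 := size_le_six hpc
  have h3 := size_le_four ha
  have h5 := hs.size_le a
  simp only [Instr.cost]
  omega

end

/-! ### The program -/

/-- Cumulative sums of the weights `a`. -/
def cum (a : ℕ → ℕ) (j : ℕ) : ℕ := ∑ i ∈ Finset.range j, a i

/-- The part of the sampler that does not depend on the weights one by one, where `m` is the sum of
the `n` weights. Register `0` holds `Z`, register `1` holds `M`. The other working registers are
scratch, except for register `10`, which is always `0`. The instructions are `0`: start;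
`1`-`7`: as long as `M < 2 ^ K`, toss a coin; `8`-`12`: division by `m`; `13`-`24`: binary search
in the table of cumulative weights, which begins in register `16`; `25`-`35`: output and
recycling; `36`-`38`: restart from `Z = 0`, `M = 1`. -/
def mainLoop (m n K : ℕ) : Program :=
  [.jle 0 0 39,
   .const 2 (2 ^ K),
   .jle 2 1 8,
   .toss 3,
   .arith .add 0 0 0,
   .arith .add 0 0 3,
   .arith .add 1 1 1,
   .jle 0 0 1,
   .const 2 m,
   .arith .div 3 1 2,
   .arith .div 4 0 2,
   .arith .mod 5 0 2,
   .jle 3 4 36,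
   .const 6 16,
   .const 7 (16 + n),
   .arith .add 8 6 7,
   .const 2 2,
   .arith .div 8 8 2,
   .jle 8 6 25,
   .load 9 8,
   .jle 9 5 23,
   .arith .add 7 8 10,
   .jle 0 0 15,
   .arith .add 6 8 10,
   .jle 0 0 15,
   .load 8 6,
   .load 9 7,
   .arith .sub 5 5 8,
   .arith .sub 9 9 8,
   .arith .mul 4 4 9,
   .arith .add 0 4 5,
   .arith .mul 1 3 9,
   .const 2 16,
   .arith .sub 2 6 2,
   .out 2,
   .jle 0 0 1,
   .const 0 0,
   .const 1 1,
   .jle 0 0 1]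

/-- The part of the sampler that writes the table of cumulative weights. -/
def tableInit (a : ℕ → ℕ) (n : ℕ) : Program :=
  (List.range (n + 1)).map (fun j => .const (16 + j) (cum a j)) ++ [.jle 0 0 36]

/-- The sampler for the distribution with weights `a 0, …, a (n - 1)`, which keeps
`M < 2 ^ (K + 1)`. -/
def sampler (a : ℕ → ℕ) (n K : ℕ) : Program :=
  mainLoop (cum a n) n K ++ tableInit a n

/-- The registers hold the table of cumulative weights and are ready for the main loop with the
values `Z` and `M`. -/
structure Ready (a : ℕ → ℕ) (n K Z M : ℕ) (r : ℕ →₀ ℕ) : Prop where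
  reg_zero : r 0 = Z
  reg_one : r 1 = M
  reg_ten : r 10 = 0
  table : ∀ j ≤ n, r (16 + j) = cum a j
  safe : Safe (n + 1) (2 ^ (K + 1)) r

section

variable {a : ℕ → ℕ} {n K Z M : ℕ} {r : ℕ →₀ ℕ} {o : List ℕ}

lemma cum_succ (a : ℕ → ℕ) (j : ℕ) : cum a (j + 1) = cum a j + a j := Finset.sum_range_succ _ _

lemma cum_mono (a : ℕ → ℕ) : Monotone (cum a) :=
  monotone_nat_of_le_succ fun j => by rw [cum_succ]; omega

lemma update_table {d v j : ℕ} (hd : d < 16) (r : ℕ → ℕ) :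
    Function.update r d v (16 + j) = r (16 + j) :=
  Function.update_of_ne (by omega) _ _

lemma leads_toss (hr : Ready a n K Z M r) (hM : M < 2 ^ K) :
    Leads (sampler a n K) (n + 1) (2 ^ (K + 1)) 2 0 1 r o
      (fun pc r' o' => pc = 3 ∧ Ready a n K Z M r' ∧ o' = o) := by
  have hB : 2 ^ (K + 1) = 2 * 2 ^ K := by ring
  refine leads_const rfl (by norm_num) (by norm_num) (by omega) hr.safe fun hs => ?_
  refine leads_jle_last_of_lt rfl (by norm_num) (by norm_num) (by norm_num) (by norm_num)
    ?_ hs ⟨rfl, ⟨?_, ?_, ?_, ?_, hs⟩, rfl⟩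
  · simpa [hr.reg_one] using hM
  · simp [hr.reg_zero]
  · simp [hr.reg_one]
  · simp [hr.reg_ten]
  · intro j hj
    simp [update_table, hr.table j hj]

lemma leads_after_toss {b : ℕ} (hr : Ready a n K Z M r) (h3 : r 3 = b) (hM : M < 2 ^ K)
    (hZ : 2 * Z + b < 2 ^ (K + 1)) :
    Leads (sampler a n K) (n + 1) (2 ^ (K + 1)) 4 0 4 r o
      (fun pc r' o' => pc = 1 ∧ Ready a n K (2 * Z + b) (2 * M) r' ∧ o' = o) := by
  have hB : 2 ^ (K + 1) = 2 * 2 ^ K := by ring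
  refine leads_add (2 * Z) rfl (by norm_num) (by norm_num) (by norm_num) (by norm_num)
    (by rw [hr.reg_zero]; omega) (by omega) hr.safe fun hs => ?_
  refine leads_add (2 * Z + b) rfl (by norm_num) (by norm_num) (by norm_num) (by norm_num)
    (by simp [h3]) (by omega) hs fun hs => ?_
  refine leads_add (2 * M) rfl (by norm_num) (by norm_num) (by norm_num) (by norm_num)
    (by simp [hr.reg_one, two_mul]) (by omega) hs fun hs => ?_
  refine leads_jle_last rfl (by norm_num) (by norm_num) (by norm_num) (by norm_num)
    le_rfl hs ⟨rfl, ⟨?_, ?_, ?_, ?_, hs⟩, rfl⟩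
  · simp
  · simp
  · simp [hr.reg_ten]
  · intro j hj
    simp [update_table, hr.table j hj]

lemma leads_restart (hs : Safe (n + 1) (2 ^ (K + 1)) r) (h10 : r 10 = 0)
    (ht : ∀ j ≤ n, r (16 + j) = cum a j) :
    Leads (sampler a n K) (n + 1) (2 ^ (K + 1)) 3 0 36 r o
      (fun pc r' o' => pc = 1 ∧ Ready a n K 0 1 r' ∧ o' = o) := by
  refine leads_const rfl (by norm_num) (by norm_num) (Nat.zero_le _) hs fun hs => ?_
  refine leads_const rfl (by norm_num) (by norm_num) Nat.one_le_two_pow hs fun hs => ?_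
  refine leads_jle_last rfl (by norm_num) (by norm_num) (by norm_num) (by norm_num)
    le_rfl hs ⟨rfl, ⟨?_, ?_, ?_, ?_, hs⟩, rfl⟩
  · simp
  · simp
  · simp [h10]
  · intro j hj
    simp [update_table, ht j hj]

/-- The registers `q`, `s` and `ρ` after the division of `M` and `Z` by the sum of the weights. -/
structure Divided (a : ℕ → ℕ) (n K q s ρ : ℕ) (r : ℕ →₀ ℕ) : Prop where
  reg_three : r 3 = q
  reg_four : r 4 = s
  reg_five : r 5 = ρ
  reg_ten : r 10 = 0
  table : ∀ j ≤ n, r (16 + j) = cum a j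
  safe : Safe (n + 1) (2 ^ (K + 1)) r

/-- An update of a register that is not in use at that time. -/
lemma Divided.update {q s ρ d v : ℕ} (hr : Divided a n K q s ρ r)
    (hs : Safe (n + 1) (2 ^ (K + 1)) (r.update d v))
    (hd : d < 16) (h3 : 3 ≠ d) (h4 : 4 ≠ d) (h5 : 5 ≠ d) (h10 : 10 ≠ d) :
    Divided a n K q s ρ (r.update d v) := by
  refine ⟨?_, ?_, ?_, ?_, ?_, hs⟩
  · simp [h3, hr.reg_three]
  · simp [h4, hr.reg_four]
  · simp [h5, hr.reg_five]
  · simp [h10, hr.reg_ten]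
  · intro j hj
    simp [update_table hd, hr.table j hj]

lemma leads_divide (hr : Ready a n K Z M r) (hm : cum a n ≤ 2 ^ K) (hM : 2 ^ K ≤ M) :
    Leads (sampler a n K) (n + 1) (2 ^ (K + 1)) 3 3 1 r o
      (fun pc r' o' => pc = 12 ∧ o' = o ∧
        Divided a n K (M / cum a n) (Z / cum a n) (Z % cum a n) r') := by
  have hB : 2 ^ (K + 1) = 2 * 2 ^ K := by ring
  have hZB : Z ≤ 2 ^ (K + 1) := hr.reg_zero ▸ (hr.safe 0).1
  have hMB : M ≤ 2 ^ (K + 1) := hr.reg_one ▸ (hr.safe 1).1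
  refine leads_const rfl (by norm_num) (by norm_num) (by omega) hr.safe fun hs => ?_
  refine leads_jle rfl (by norm_num) (by norm_num) (by norm_num) (by norm_num)
    (by simpa [hr.reg_one] using hM) hs ?_
  refine leads_const rfl (by norm_num) (by norm_num) (by omega) hs fun hs => ?_
  refine leads_arith (M / cum a n) rfl (by norm_num) (by norm_num) (by norm_num) (by norm_num)
    (by simp [Op.eval, hr.reg_one]) ((Nat.div_le_self _ _).trans hMB) hs fun hs => ?_
  refine leads_arith (Z / cum a n) rfl (by norm_num) (by norm_num) (by norm_num) (by norm_num)
    (by simp [Op.eval, hr.reg_zero]) ((Nat.div_le_self _ _).trans hZB) hs fun hs => ?_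
  refine leads_arith_last (Z % cum a n) rfl (by norm_num) (by norm_num) (by norm_num) (by norm_num)
    (by simp [Op.eval, hr.reg_zero]) ((Nat.mod_le _ _).trans hZB) hs fun hs => ?_
  refine ⟨rfl, rfl, ?_, ?_, ?_, ?_, ?_, hs⟩
  · simp
  · simp
  · simp
  · simp [hr.reg_ten]
  · intro j hj
    simp [update_table, hr.table j hj]

/-- The step without an output, when `Z` lies in the remainder of `M` modulo the sum of the
weights. -/
lemma leads_fail (hr : Ready a n K Z M r) (hm : cum a n ≤ 2 ^ K) (hM : 2 ^ K ≤ M)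
    (h : M / cum a n ≤ Z / cum a n) :
    Leads (sampler a n K) (n + 1) (2 ^ (K + 1)) 7 3 1 r o
      (fun pc r' o' => pc = 1 ∧ Ready a n K 0 1 r' ∧ o' = o) := by
  refine ((leads_divide hr hm hM).trans (x' := 4) (y' := 0) ?_).mono le_rfl le_rfl
    fun _ _ _ => id
  rintro _ r _ ⟨rfl, rfl, hr⟩
  refine leads_jle rfl (by norm_num) (by norm_num) (by norm_num) (by norm_num)
    (by rwa [hr.reg_three, hr.reg_four]) hr.safe ?_
  exact leads_restart hr.safe hr.reg_ten hr.table

/-- The computation of the middle of the interval, with which each round of the search begins. -/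
lemma leads_mid {q s ρ lo hi x y : ℕ} {Q : ℕ → (ℕ →₀ ℕ) → List ℕ → Prop}
    (hn : 16 + n ≤ 2 ^ K) (hr : Divided a n K q s ρ r) (h6 : r 6 = lo) (h7 : r 7 = hi)
    (hlo : lo ≤ 16 + n) (hhi : hi ≤ 16 + n)
    (next : ∀ r', Divided a n K q s ρ r' → r' 6 = lo → r' 7 = hi → r' 8 = (lo + hi) / 2 →
      Leads (sampler a n K) (n + 1) (2 ^ (K + 1)) x y 18 r' o Q) :
    Leads (sampler a n K) (n + 1) (2 ^ (K + 1)) (x + 3) y 15 r o Q := by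
  have hB : 2 ^ (K + 1) = 2 * 2 ^ K := by ring
  refine leads_add (lo + hi) rfl (by norm_num) (by norm_num) (by norm_num)
    (by norm_num) (by rw [h6, h7]) (by omega) hr.safe fun hs => ?_
  replace hr := hr.update hs (by norm_num) (by norm_num) (by norm_num) (by norm_num) (by norm_num)
  refine leads_const rfl (by norm_num) (by norm_num) (by omega) hs fun hs => ?_
  replace hr := hr.update hs (by norm_num) (by norm_num) (by norm_num) (by norm_num) (by norm_num)
  refine leads_half ((lo + hi) / 2) rfl (by norm_num) (by norm_num) (by norm_num)
    (by norm_num) (by simp) (by simp) hs fun hs => ?_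
  replace hr := hr.update hs (by norm_num) (by norm_num) (by norm_num) (by norm_num) (by norm_num)
  exact next _ hr (by simp [h6]) (by simp [h7]) (by simp)

/-- The binary search, which finds the index `i` with `cum a i ≤ ρ < cum a (i + 1)`. -/
lemma leads_search {q s ρ i : ℕ} (hn : 16 + n ≤ 2 ^ K) (h1 : cum a i ≤ ρ)
    (h2 : ρ < cum a (i + 1)) (L : ℕ) {lo hi : ℕ} {r : ℕ →₀ ℕ} (hr : Divided a n K q s ρ r)
    (h6 : r 6 = lo) (h7 : r 7 = hi) (hL : hi - lo ≤ 2 ^ L) (hlo : lo ≤ 16 + i)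
    (hhi : 16 + i < hi) (hhn : hi ≤ 16 + n) (h16 : 16 ≤ lo) :
    Leads (sampler a n K) (n + 1) (2 ^ (K + 1)) (8 * L + 4) 0 15 r o
      (fun pc r' o' => pc = 25 ∧ o' = o ∧ Divided a n K q s ρ r' ∧
        r' 6 = 16 + i ∧ r' 7 = 16 + (i + 1)) := by
  have hB : 2 ^ (K + 1) = 2 * 2 ^ K := by ring
  induction L generalizing lo hi r with
  | zero =>
    obtain ⟨rfl, rfl⟩ : lo = 16 + i ∧ hi = 16 + (i + 1) := by simp at hL; omega
    refine leads_mid (x := 1) hn hr h6 h7 (by omega) (by omega) fun r' hr h6 h7 h8 => ?_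
    exact leads_jle_last rfl (by norm_num) (by norm_num) (by norm_num) (by norm_num)
      (by omega) hr.safe ⟨rfl, rfl, hr, h6, h7⟩
  | succ L ih =>
    have hL2 : 2 ^ (L + 1) = 2 * 2 ^ L := by ring
    refine leads_mid (x := 8 * L + 9) hn hr h6 h7 (by omega) (by omega)
      fun r hr h6 h7 h8 => ?_
    rcases Nat.lt_or_ge (lo + 1) hi with hlt | hge
    · obtain ⟨mid, hmid⟩ : ∃ mid, (lo + hi) / 2 = 16 + mid := ⟨(lo + hi) / 2 - 16, by omega⟩
      rw [hmid] at h8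
      refine leads_jle_of_lt rfl (by norm_num) (by norm_num) (by norm_num) (by norm_num)
        (by omega) hr.safe ?_
      refine leads_load (cum a mid) rfl (by norm_num) (by norm_num) (by norm_num)
        (by rw [h8, hr.table mid (by omega)]) hr.safe fun hs => ?_
      replace hr := hr.update hs (by norm_num) (by norm_num) (by norm_num) (by norm_num)
        (by norm_num)
      rcases Nat.lt_or_ge i mid with hlt' | hge'
      · refine leads_jle_of_lt rfl (by norm_num) (by norm_num) (by norm_num) (by norm_num)
          (by rw [hr.reg_five]; simpa using h2.trans_le (cum_mono a hlt')) hs ?_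
        refine leads_add (16 + mid) rfl (by norm_num) (by norm_num) (by norm_num) (by norm_num)
          (by rw [hr.reg_ten]; simp [h8]) (by omega) hs fun hs => ?_
        replace hr := hr.update hs (by norm_num) (by norm_num) (by norm_num) (by norm_num)
          (by norm_num)
        refine leads_jle rfl (by norm_num) (by norm_num) (by norm_num) (by norm_num)
          le_rfl hs ?_
        exact (ih (lo := lo) (hi := 16 + mid) hr (by simp [h6]) (by simp)
          (by omega) (by omega) (by omega) (by omega)
          (by omega)).mono (by omega) le_rfl fun _ _ _ => id
      · refine leads_jle rfl (by norm_num) (by norm_num) (by norm_num) (by norm_num)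
          (by rw [hr.reg_five]; simpa using (cum_mono a hge').trans h1) hs ?_
        refine leads_add (16 + mid) rfl (by norm_num) (by norm_num) (by norm_num) (by norm_num)
          (by rw [hr.reg_ten]; simp [h8]) (by omega) hs fun hs => ?_
        replace hr := hr.update hs (by norm_num) (by norm_num) (by norm_num) (by norm_num)
          (by norm_num)
        refine leads_jle rfl (by norm_num) (by norm_num) (by norm_num) (by norm_num)
          le_rfl hs ?_
        exact (ih (lo := 16 + mid) (hi := hi) hr (by simp) (by simp [h7])
          (by omega) (by omega) (by omega) (by omega)
          (by omega)).mono (by omega) le_rfl fun _ _ _ => id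
    · obtain ⟨rfl, rfl⟩ : lo = 16 + i ∧ hi = 16 + (i + 1) := by omega
      refine Leads.mono (x := 1) ?_ (by omega) le_rfl fun _ _ _ => id
      exact leads_jle_last rfl (by norm_num) (by norm_num) (by norm_num) (by norm_num)
        (by omega) hr.safe ⟨rfl, rfl, hr, h6, h7⟩

/-- The output of the index `i`, and the recycling of the remaining randomness. -/
lemma leads_recycle {q s ρ i : ℕ} (hn : 16 + n ≤ 2 ^ K) (h1 : cum a i ≤ ρ)
    (h2 : ρ < cum a (i + 1)) (hi : i < n) (hr : Divided a n K q s ρ r)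
    (h6 : r 6 = 16 + i) (h7 : r 7 = 16 + (i + 1)) (hq : q * a i ≤ 2 ^ (K + 1)) (hs : s < q) :
    Leads (sampler a n K) (n + 1) (2 ^ (K + 1)) 9 2 25 r o
      (fun pc r' o' => pc = 1 ∧ Ready a n K (s * a i + (ρ - cum a i)) (q * a i) r' ∧
        o' = o ++ [i]) := by
  have hB : 2 ^ (K + 1) = 2 * 2 ^ K := by ring
  have hc := cum_succ a i
  have hsq : s * a i + a i ≤ q * a i := by
    rw [← Nat.succ_mul]; exact Nat.mul_le_mul_right _ hs
  refine leads_load (cum a i) rfl (by norm_num) (by norm_num) (by norm_num)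
    (by rw [h6, hr.table i (by omega)]) hr.safe fun hs => ?_
  refine leads_load (cum a (i + 1)) rfl (by norm_num) (by norm_num) (by norm_num)
    (by simp [h7, update_table, hr.table (i + 1) (by omega)]) hs fun hs => ?_
  refine leads_sub (ρ - cum a i) rfl (by norm_num) (by norm_num) (by norm_num) (by norm_num)
    (by simp [hr.reg_five]) hs fun hs => ?_
  refine leads_sub (a i) rfl (by norm_num) (by norm_num) (by norm_num) (by norm_num)
    (by simp [hc]) hs fun hs => ?_
  refine leads_arith (s * a i) rfl (by norm_num) (by norm_num) (by norm_num) (by norm_num)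
    (by simp [Op.eval, hr.reg_four]) (by omega) hs fun hs => ?_
  refine leads_add (s * a i + (ρ - cum a i)) rfl (by norm_num) (by norm_num) (by norm_num)
    (by norm_num) (by simp) (by omega) hs fun hs => ?_
  refine leads_arith (q * a i) rfl (by norm_num) (by norm_num) (by norm_num) (by norm_num)
    (by simp [Op.eval, hr.reg_three]) (by omega) hs fun hs => ?_
  refine leads_const rfl (by norm_num) (by norm_num) (by omega) hs fun hs => ?_
  refine leads_sub i rfl (by norm_num) (by norm_num) (by norm_num) (by norm_num)
    (by simp [h6]) hs fun hs => ?_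
  refine leads_out i rfl (by norm_num) (by norm_num) (by simp) hs ?_
  refine leads_jle_last rfl (by norm_num) (by norm_num) (by norm_num) (by norm_num)
    le_rfl hs ⟨rfl, ⟨?_, ?_, ?_, ?_, hs⟩, rfl⟩
  · simp
  · simp
  · simp [hr.reg_ten]
  · intro j hj
    simp [update_table, hr.table j hj]

/-- The step with an output: `Z` is written as `s * m + cum a i + x`, where `m` is the sum of the
weights and `x < a i`. Then `i` is the output, and `s * a i + x` is uniform on `q * a i` values. -/
lemma leads_output {s i x : ℕ} (hn : 16 + n ≤ 2 ^ K) (hm : cum a n ≤ 2 ^ K) (hi : i < n)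
    (hx : x < a i) (hM : 2 ^ K ≤ M) (hs : s < M / cum a n)
    (hr : Ready a n K (s * cum a n + (cum a i + x)) M r) :
    Leads (sampler a n K) (n + 1) (2 ^ (K + 1)) (8 * K + 19) 5 1 r o
      (fun pc r' o' => pc = 1 ∧ Ready a n K (s * a i + x) (M / cum a n * a i) r' ∧
        o' = o ++ [i]) := by
  have hMB : M ≤ 2 ^ (K + 1) := hr.reg_one ▸ (hr.safe 1).1
  have hc := cum_succ a i
  have hlt : cum a i + x < cum a n := by
    have := cum_mono a (show i + 1 ≤ n from hi)
    omega
  have hpos : 0 < cum a n := by omega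
  have hdiv : (s * cum a n + (cum a i + x)) / cum a n = s := by
    rw [add_comm, Nat.add_mul_div_right _ _ hpos, Nat.div_eq_of_lt hlt, zero_add]
  have hmod : (s * cum a n + (cum a i + x)) % cum a n = cum a i + x := by
    rw [add_comm, Nat.add_mul_mod_self_right, Nat.mod_eq_of_lt hlt]
  have hB : 2 ^ (K + 1) = 2 * 2 ^ K := by ring
  have hq : M / cum a n * a i ≤ 2 ^ (K + 1) := by
    refine (Nat.mul_le_mul_left _ (show a i ≤ cum a n from ?_)).trans
      ((Nat.div_mul_le_self _ _).trans hMB)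
    have := cum_mono a (show i + 1 ≤ n from hi)
    omega
  have h := leads_divide (o := o) hr hm hM
  rw [hdiv, hmod] at h
  refine (h.trans (x' := 8 * K + 16) (y' := 2) ?_).mono (by omega) le_rfl fun _ _ _ => id
  rintro _ r o' ⟨rfl, ho, hr⟩
  rw [ho]
  refine leads_jle_of_lt (x := 8 * K + 15) rfl (by norm_num) (by norm_num) (by norm_num)
    (by norm_num) (by rwa [hr.reg_three, hr.reg_four]) hr.safe ?_
  refine leads_const rfl (by norm_num) (by norm_num) (by omega) hr.safe fun hs => ?_
  replace hr := hr.update hs (by norm_num) (by norm_num) (by norm_num) (by norm_num) (by norm_num)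
  refine leads_const rfl (by norm_num) (by norm_num) (by omega) hs fun hs => ?_
  replace hr := hr.update hs (by norm_num) (by norm_num) (by norm_num) (by norm_num) (by norm_num)
  refine ((leads_search (lo := 16) (hi := 16 + n) hn (i := i) (by omega) (by omega) K hr (by simp)
    (by simp) (by omega) (by omega) (by omega) le_rfl le_rfl).trans (x' := 9) (y' := 2) ?_).mono
    (by omega) (by omega) fun _ _ _ => id
  rintro _ r o' ⟨rfl, ho, hr, h6, h7⟩
  rw [ho]
  have h := leads_recycle (o := o) hn (by omega) (by omega) hi hr h6 h7 hq ‹_›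
  rwa [Nat.add_sub_cancel_left] at h

/-! ### The start of the program -/

lemma sampler_getElem_table {j : ℕ} (hj : j ≤ n) :
    (sampler a n K)[39 + j]? = some (.const (16 + j) (cum a j)) := by
  have h : (sampler a n K)[39 + j]? = (tableInit a n)[j]? := by
    rw [sampler, List.getElem?_append_right (by simp [mainLoop])]
    simp [mainLoop]
  rw [h, tableInit, List.getElem?_append_left (by simp; omega)]
  simp [Nat.lt_succ_of_le hj]

lemma sampler_getElem_last : (sampler a n K)[39 + (n + 1)]? = some (.jle 0 0 36) := by
  have h : (sampler a n K)[39 + (n + 1)]? = (tableInit a n)[n + 1]? := by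
    rw [sampler, List.getElem?_append_right (by simp [mainLoop])]
    simp [mainLoop]
  rw [h, tableInit, List.getElem?_append_right (by simp)]
  simp

/-- The table is complete up to the entry `j`, and `k` entries are still to be written. The number
of bit operations does not matter, because this happens only once. -/
lemma leads_table (hm : cum a n ≤ 2 ^ K) (k : ℕ) : ∀ (j : ℕ) (r : ℕ →₀ ℕ), j + k = n + 1 →
    Safe (n + 1) (2 ^ (K + 1)) r → r 10 = 0 → (∀ i < j, r (16 + i) = cum a i) →
    ∃ x, Leads (sampler a n K) (n + 1) (2 ^ (K + 1)) x 0 (39 + j) r o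
      (fun pc r' o' => pc = 1 ∧ Ready a n K 0 1 r' ∧ o' = o) := by
  have hB : 2 ^ (K + 1) = 2 * 2 ^ K := by ring
  have hlarge : ∀ c x : ℕ, c ≤ c * (40 + 4 * x) + 0 := fun c x => by nlinarith [Nat.zero_le (c * x)]
  induction k with
  | zero =>
    rintro j r rfl hs h10 ht
    have h1 : Leads (sampler a n K) (n + 1) (2 ^ (K + 1))
        (1 + (39 + (n + 1)).size + (Instr.jle 0 0 36).cost r) 0 (39 + (n + 1)) r o
        (fun pc r' o' => pc = 36 ∧ r' = r ∧ o' = o) :=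
      leads_one sampler_getElem_last hs (by rw [zero_mul]; exact hlarge _ _)
        (fun _ _ _ => by simp [Instr.exec]) ⟨rfl, rfl, rfl⟩
    refine ⟨_, h1.trans (x' := 3) (y' := 0) ?_⟩
    rintro _ r' o' ⟨rfl, hr, ho⟩
    rw [hr, ho]
    exact leads_restart hs h10 fun i hi => ht i (by omega)
  | succ k ih =>
    rintro j r hj hs h10 ht
    have hv : cum a j ≤ 2 ^ (K + 1) := by
      have := cum_mono a (show j ≤ n by omega)
      omega
    have hs' := hs.update (d := 16 + j) (by omega) hv
    have h1 : Leads (sampler a n K) (n + 1) (2 ^ (K + 1))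
        (1 + (39 + j).size + (Instr.const (16 + j) (cum a j)).cost r) 0 (39 + j) r o
        (fun pc r' o' => pc = 39 + (j + 1) ∧ r' = r.update (16 + j) (cum a j) ∧ o' = o) :=
      leads_one (sampler_getElem_table (by omega)) hs (by rw [zero_mul]; exact hlarge _ _)
        (fun _ _ _ => rfl) ⟨rfl, rfl, rfl⟩
    obtain ⟨x, hx⟩ := ih (j + 1) _ (by omega) hs'
      (by rw [Finsupp.coe_update, Function.update_of_ne (by omega), h10]) (by
        intro i hi
        rw [Finsupp.coe_update, Function.update_apply]
        split_ifs with h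
        · congr; omega
        · exact ht i (by omega))
    refine ⟨_, h1.trans (x' := x) (y' := 0) ?_⟩
    rintro _ r' o' ⟨rfl, hr, ho⟩
    rw [hr, ho]
    exact hx

lemma safe_zero {N B : ℕ} : Safe N B 0 := fun i => by simp

lemma leads_init (hm : cum a n ≤ 2 ^ K) :
    ∃ x, Leads (sampler a n K) (n + 1) (2 ^ (K + 1)) x 0 0 0 []
      (fun pc r' o' => pc = 1 ∧ Ready a n K 0 1 r' ∧ o' = []) := by
  obtain ⟨x, hx⟩ := leads_table (o := []) hm (n + 1) 0 0 (by omega) safe_zero rfl (by simp)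
  exact ⟨_, leads_jle rfl (by norm_num) (by norm_num) (by norm_num) (by norm_num) le_rfl
    safe_zero hx⟩

end

/-! ### Averages over a uniform state -/

section

variable {a : ℕ → ℕ} {n K : ℕ}

lemma sum_range_mul (q b : ℕ) (f : ℕ → ℝ) :
    ∑ z ∈ Finset.range (q * b), f z
      = ∑ s ∈ Finset.range q, ∑ x ∈ Finset.range b, f (s * b + x) := by
  induction q with
  | zero => simp
  | succ q ih => rw [Nat.succ_mul, Finset.sum_range_add, ih, Finset.sum_range_succ]

lemma sum_range_cum (n : ℕ) (f : ℕ → ℝ) :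
    ∑ z ∈ Finset.range (cum a n), f z
      = ∑ i ∈ Finset.range n, ∑ x ∈ Finset.range (a i), f (cum a i + x) := by
  induction n with
  | zero => simp [cum]
  | succ n ih => rw [cum_succ, Finset.sum_range_add, ih, Finset.sum_range_succ]

/-- Division with remainder by the sum of the weights, as a decomposition of `Z < M`. -/
lemma sum_range_split (M : ℕ) (f : ℕ → ℝ) :
    ∑ Z ∈ Finset.range M, f Z
      = ∑ i ∈ Finset.range n, ∑ s ∈ Finset.range (M / cum a n), ∑ x ∈ Finset.range (a i),
          f (s * cum a n + (cum a i + x))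
        + ∑ Z ∈ Finset.Ico (M / cum a n * cum a n) M, f Z := by
  rw [← Finset.sum_range_add_sum_Ico f (Nat.div_mul_le_self M (cum a n)), sum_range_mul]
  congr 1
  exact (Finset.sum_congr rfl fun s _ => sum_range_cum n fun z => f (s * cum a n + z)).trans
    Finset.sum_comm

/-- A bound for large `M` carries over to small `M` through tosses, each of which costs `κ` and adds
a bit to `M`. Here `S M` is a sum over `Z < M`. -/
lemma le_of_doubling {S : ℕ → ℝ} {c κ : ℝ}
    (hd : ∀ M, 0 < M → M < 2 ^ K → 2 * S M ≤ 2 * (M * κ) + S (2 * M))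
    (h : ∀ M, 2 ^ K ≤ M → M < 2 ^ (K + 1) → S M ≤ M * (c - κ * Real.logb 2 M)) (M : ℕ)
    (h0 : 0 < M) (hM : M < 2 ^ (K + 1)) : S M ≤ M * (c - κ * Real.logb 2 M) := by
  have hK : 2 ^ (K + 1) = 2 * 2 ^ K := by ring
  obtain ⟨j, hj⟩ : ∃ j, j = 2 ^ (K + 1) - M := ⟨_, rfl⟩
  induction j using Nat.strong_induction_on generalizing M with
  | _ j ih =>
  rcases Nat.lt_or_ge M (2 ^ K) with hlt | hge
  · have h1 := ih (2 ^ (K + 1) - 2 * M) (by omega) (2 * M) (by omega) (by omega) rfl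
    have h2 := hd M h0 hlt
    have h3 : Real.logb 2 ((2 * M : ℕ) : ℝ) = 1 + Real.logb 2 M := by
      push_cast
      rw [Real.logb_mul (by norm_num) (by positivity), Real.logb_self_eq_one (by norm_num)]
    rw [h3] at h1
    push_cast at h1
    linarith
  · exact h M hge hM

/-- Entropy in bits of the distribution with weights `a 0, …, a (n - 1)`. -/
noncomputable def weightEntropy (a : ℕ → ℕ) (n : ℕ) : ℝ :=
  -∑ i ∈ Finset.range n, (a i / cum a n : ℝ) * Real.logb 2 (a i / cum a n)

lemma logb_two_natCast_le {M : ℕ} (h0 : 0 < M) (h : M < 2 ^ (K + 1)) :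
    Real.logb 2 M ≤ K + 1 := by
  rw [Real.logb_le_iff_le_rpow (by norm_num) (by positivity)]
  have : ((K : ℝ) + 1) = ((K + 1 : ℕ) : ℝ) := by push_cast; ring
  rw [this, Real.rpow_natCast]
  exact_mod_cast h.le

lemma sum_weights (a : ℕ → ℕ) (n : ℕ) : ∑ i ∈ Finset.range n, (a i : ℝ) = cum a n := by
  rw [cum]; push_cast; rfl

/-- What an output leaves of the logarithm of `M`, on average. -/
lemma sum_mul_logb (hm : 0 < cum a n) {q : ℕ} (hq : 0 < q) :
    ∑ i ∈ Finset.range n, ((q * a i : ℕ) : ℝ) * Real.logb 2 (q * a i : ℕ)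
      = (q * cum a n : ℕ) * (Real.logb 2 (q * cum a n : ℕ) - weightEntropy a n) := by
  have hm' : (cum a n : ℝ) ≠ 0 := by positivity
  have hq' : (q : ℝ) ≠ 0 := by positivity
  have h : ∀ i ∈ Finset.range n, ((q * a i : ℕ) : ℝ) * Real.logb 2 (q * a i : ℕ)
      = q * Real.logb 2 (q * cum a n : ℕ) * a i
        + (q * cum a n) * ((a i / cum a n : ℝ) * Real.logb 2 (a i / cum a n)) := by
    intro i _
    rcases Nat.eq_zero_or_pos (a i) with h0 | h0
    · simp [h0]
    · have ha : (a i : ℝ) ≠ 0 := by positivity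
      push_cast
      rw [Real.logb_div ha hm', Real.logb_mul hq' ha, Real.logb_mul hq' hm']
      field_simp
      ring
  rw [Finset.sum_congr rfl h, Finset.sum_add_distrib, ← Finset.mul_sum, ← Finset.mul_sum,
    sum_weights, weightEntropy]
  push_cast
  ring

/-- The expected cost `V k Z M` until `k` more outputs, from the state `Z`, `M` on, where `κt` is
the cost of a toss and `κd` that of a division. The average over `Z < M` is at most
`E * k + κt * (K + 1 - logb 2 M)`, where `E` is the cost per output. The term with the logarithm
credits the randomness that is still available. -/
lemma cost_le {V : ℕ → ℕ → ℕ → ℝ} {κt κd ε : ℝ} (hκt : 0 ≤ κt) (hκd : 0 ≤ κd)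
    (hm : 0 < cum a n) (hmK : cum a n ≤ 2 ^ K)
    (hkey : ∀ M : ℕ, 2 ^ K ≤ M → M < 2 ^ (K + 1) →
      (M : ℝ) ≤ 2 * (M / cum a n * cum a n : ℕ) ∧
      M * Real.logb 2 M - (M / cum a n * cum a n : ℕ) * Real.logb 2 (M / cum a n * cum a n : ℕ)
        ≤ (M / cum a n * cum a n : ℕ) * ε)
    (h0 : ∀ Z M, V 0 Z M ≤ 0)
    (htoss : ∀ k Z M, Z < M → M < 2 ^ K →
      V k Z M ≤ κt + (V k (2 * Z) (2 * M) + V k (2 * Z + 1) (2 * M)) / 2)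
    (hout : ∀ k M s i x, 2 ^ K ≤ M → M < 2 ^ (K + 1) → s < M / cum a n → i < n → x < a i →
      V (k + 1) (s * cum a n + (cum a i + x)) M ≤ κd + V k (s * a i + x) (M / cum a n * a i))
    (hfail : ∀ k Z M, 2 ^ K ≤ M → M < 2 ^ (K + 1) → Z < M → M / cum a n ≤ Z / cum a n →
      V (k + 1) Z M ≤ κd + V (k + 1) 0 1) (k : ℕ) :
    V k 0 1 ≤ (κt * (weightEntropy a n + ε) + 2 * κd) * k + κt * (K + 1) := by
  set S : ℕ → ℕ → ℝ := fun k M => ∑ Z ∈ Finset.range M, V k Z M with hS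
  set E : ℝ := κt * (weightEntropy a n + ε) + 2 * κd with hE
  have hS1 : ∀ k, S k 1 = V k 0 1 := fun k => by simp [hS]
  have hdouble : ∀ k M, 0 < M → M < 2 ^ K → 2 * S k M ≤ 2 * (M * κt) + S k (2 * M) := by
    intro k M _ hM
    have h1 : S k (2 * M)
        = ∑ Z ∈ Finset.range M, (V k (2 * Z) (2 * M) + V k (2 * Z + 1) (2 * M)) := by
      simp only [hS]
      rw [mul_comm 2 M, sum_range_mul]
      refine Finset.sum_congr rfl fun Z _ => ?_
      rw [Finset.sum_range_succ, Finset.sum_range_one, add_zero, mul_comm Z 2]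
    have h2 : S k M ≤ ∑ Z ∈ Finset.range M,
        (κt + (V k (2 * Z) (2 * M) + V k (2 * Z + 1) (2 * M)) / 2) :=
      Finset.sum_le_sum fun Z hZ => htoss k Z M (Finset.mem_range.1 hZ) hM
    rw [Finset.sum_add_distrib, ← Finset.sum_div, ← h1, Finset.sum_const, Finset.card_range,
      nsmul_eq_mul] at h2
    linarith
  suffices h : ∀ k M, 0 < M → M < 2 ^ (K + 1) →
      S k M ≤ M * ((E * k + κt * (K + 1)) - κt * Real.logb 2 M) by
    have := h k 1 one_pos (Nat.one_lt_two_pow (by omega))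
    rw [hS1] at this
    simpa using this
  clear k
  intro k
  induction k with
  | zero =>
    intro M hM0 hM
    have h1 : S 0 M ≤ 0 := Finset.sum_nonpos fun Z _ => h0 Z M
    have h2 := logb_two_natCast_le hM0 hM
    have h3 : 0 ≤ (M : ℝ) * (κt * ((K + 1) - Real.logb 2 M)) :=
      mul_nonneg (by positivity) (mul_nonneg hκt (by linarith))
    push_cast
    linarith
  | succ k ih =>
    set Y : ℝ := E * (k + 1 : ℕ) + κt * (K + 1) with hY
    set x : ℝ := V (k + 1) 0 1 with hx
    have hround : ∀ M : ℕ, 2 ^ K ≤ M → M < 2 ^ (K + 1) →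
        S (k + 1) M ≤ M * (Y - κt * Real.logb 2 M)
          + (M - (M / cum a n * cum a n : ℕ)) * (x - Y) := by
      intro M hM1 hM2
      obtain ⟨hk1, hk2⟩ := hkey M hM1 hM2
      have hQ : M / cum a n * cum a n ≤ M := Nat.div_mul_le_self _ _
      have hq : 0 < M / cum a n := Nat.div_pos (hmK.trans hM1) hm
      have h1 : S (k + 1) M ≤ M * κd + ∑ i ∈ Finset.range n, S k (M / cum a n * a i)
          + (M - (M / cum a n * cum a n : ℕ)) * x := by
        have hle : S (k + 1) M ≤ ∑ i ∈ Finset.range n, ∑ s ∈ Finset.range (M / cum a n),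
            ∑ y ∈ Finset.range (a i), (κd + V k (s * a i + y) (M / cum a n * a i))
            + ∑ Z ∈ Finset.Ico (M / cum a n * cum a n) M, (κd + x) := by
          simp only [hS]
          rw [sum_range_split (a := a) (n := n) M]
          refine add_le_add (Finset.sum_le_sum fun i hi => Finset.sum_le_sum fun s hs =>
            Finset.sum_le_sum fun y hy => ?_) (Finset.sum_le_sum fun Z hZ => ?_)
          · exact hout k M s i y hM1 hM2 (Finset.mem_range.1 hs) (Finset.mem_range.1 hi)
              (Finset.mem_range.1 hy)
          · rw [Finset.mem_Ico] at hZ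
            exact hfail k Z M hM1 hM2 hZ.2 ((Nat.le_div_iff_mul_le hm).2 hZ.1)
        refine hle.trans (le_of_eq ?_)
        have h2 : ∀ i, ∑ s ∈ Finset.range (M / cum a n), ∑ y ∈ Finset.range (a i),
            (κd + V k (s * a i + y) (M / cum a n * a i))
            = (M / cum a n : ℕ) * κd * a i + S k (M / cum a n * a i) := by
          intro i
          simp only [hS, Finset.sum_add_distrib, sum_range_mul, Finset.sum_const,
            Finset.card_range, nsmul_eq_mul]
          ring
        simp only [h2]
        rw [Finset.sum_add_distrib, ← Finset.mul_sum, sum_weights, Finset.sum_const, Nat.card_Ico,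
          nsmul_eq_mul, Nat.cast_sub hQ]
        push_cast
        ring
      have h2 : ∑ i ∈ Finset.range n, S k (M / cum a n * a i)
          ≤ ∑ i ∈ Finset.range n, ((M / cum a n : ℕ) * (E * k + κt * (K + 1)) * a i
            - κt * (((M / cum a n * a i : ℕ) : ℝ) * Real.logb 2 (M / cum a n * a i : ℕ))) := by
        refine Finset.sum_le_sum fun i hi => ?_
        rcases Nat.eq_zero_or_pos (a i) with h0 | h0
        · simp [h0, hS]
        · have hai : a i ≤ cum a n := by
            have := cum_mono a (show i + 1 ≤ n from Finset.mem_range.1 hi)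
            have := cum_succ a i
            omega
          refine (ih (M / cum a n * a i) (Nat.mul_pos hq h0)
            (((Nat.mul_le_mul_left _ hai).trans hQ).trans_lt hM2)).trans (le_of_eq ?_)
          push_cast
          ring
      rw [Finset.sum_sub_distrib, ← Finset.mul_sum, ← Finset.mul_sum, sum_weights,
        sum_mul_logb hm hq] at h2
      have h3 := mul_le_mul_of_nonneg_left hk2 hκt
      have h4 := mul_le_mul_of_nonneg_left hk1 hκd
      push_cast at h1 h2 h3 h4 ⊢
      rw [hY, hE]
      push_cast
      rw [hE] at h2
      linarith
    -- If `x` exceeded `Y`, doubling would improve the bound on `x` by half of the excess.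
    have hxY : x ≤ Y := by
      by_contra! hlt
      have h1 := le_of_doubling (S := S (k + 1)) (c := Y + (x - Y) / 2) (κ := κt)
        (hdouble (k + 1)) (fun M hM1 hM2 => by
          have h2 := hround M hM1 hM2
          have h3 := (hkey M hM1 hM2).1
          have h4 : ((M : ℝ) - (M / cum a n * cum a n : ℕ)) * (x - Y) ≤ M / 2 * (x - Y) :=
            mul_le_mul_of_nonneg_right (by linarith) (by linarith)
          linarith) 1 one_pos (Nat.one_lt_two_pow (by omega))
      rw [hS1] at h1
      simp at h1
      linarith
    refine le_of_doubling (hdouble (k + 1)) fun M hM1 hM2 => ?_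
    have h1 := hround M hM1 hM2
    have h2 : ((M / cum a n * cum a n : ℕ) : ℝ) ≤ M := by
      exact_mod_cast Nat.div_mul_le_self M (cum a n)
    have h3 : ((M : ℝ) - (M / cum a n * cum a n : ℕ)) * (x - Y) ≤ 0 :=
      mul_nonpos_of_nonneg_of_nonpos (by linarith) (by linarith)
    linarith

/-- The probability `U w Z M` of the outputs `w`, from the state `Z`, `M` on: averaged over `Z < M`,
it is at least the product of the probabilities of the letters. -/
lemma prod_le_prob {U : List ℕ → ℕ → ℕ → ℝ} (hm : 0 < cum a n) (hmK : cum a n ≤ 2 ^ K)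
    (hkey : ∀ M : ℕ, 2 ^ K ≤ M → M < 2 ^ (K + 1) → (M : ℝ) ≤ 2 * (M / cum a n * cum a n : ℕ))
    (hU : ∀ w Z M, 0 ≤ U w Z M) (h0 : ∀ Z M, 1 ≤ U [] Z M)
    (htoss : ∀ w Z M, Z < M → M < 2 ^ K →
      (U w (2 * Z) (2 * M) + U w (2 * Z + 1) (2 * M)) / 2 ≤ U w Z M)
    (hout : ∀ w M s i x, 2 ^ K ≤ M → M < 2 ^ (K + 1) → s < M / cum a n → i < n → x < a i →
      U w (s * a i + x) (M / cum a n * a i) ≤ U (i :: w) (s * cum a n + (cum a i + x)) M)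
    (hfail : ∀ w Z M, 2 ^ K ≤ M → M < 2 ^ (K + 1) → Z < M → M / cum a n ≤ Z / cum a n →
      U w 0 1 ≤ U w Z M) (w : List ℕ) (hw : ∀ i ∈ w, i < n) :
    (w.map fun i => (a i / cum a n : ℝ)).prod ≤ U w 0 1 := by
  set S : List ℕ → ℕ → ℝ := fun w M => ∑ Z ∈ Finset.range M, U w Z M with hS
  have hS1 : ∀ w, S w 1 = U w 0 1 := fun w => by simp [hS]
  have hm' : (cum a n : ℝ) ≠ 0 := by positivity
  have hdouble : ∀ w M, 0 < M → M < 2 ^ K → 2 * -S w M ≤ 2 * (M * 0) + -S w (2 * M) := by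
    intro w M _ hM
    have h1 : S w (2 * M)
        = ∑ Z ∈ Finset.range M, (U w (2 * Z) (2 * M) + U w (2 * Z + 1) (2 * M)) := by
      simp only [hS]
      rw [mul_comm 2 M, sum_range_mul]
      refine Finset.sum_congr rfl fun Z _ => ?_
      rw [Finset.sum_range_succ, Finset.sum_range_one, add_zero, mul_comm Z 2]
    have h2 : ∑ Z ∈ Finset.range M,
        ((U w (2 * Z) (2 * M) + U w (2 * Z + 1) (2 * M)) / 2) ≤ S w M :=
      Finset.sum_le_sum fun Z hZ => htoss w Z M (Finset.mem_range.1 hZ) hM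
    rw [← Finset.sum_div, ← h1] at h2
    linarith
  suffices h : ∀ M, 0 < M → M < 2 ^ (K + 1) →
      M * (w.map fun i => (a i / cum a n : ℝ)).prod ≤ S w M by
    have := h 1 one_pos (Nat.one_lt_two_pow (by omega))
    rw [hS1] at this
    simpa using this
  induction w with
  | nil =>
    intro M _ _
    have : ∑ _Z ∈ Finset.range M, (1 : ℝ) ≤ S [] M := Finset.sum_le_sum fun Z _ => h0 Z M
    simpa using this
  | cons i w ih =>
    replace ih := ih fun j hj => hw j (by simp [hj])
    have hi : i < n := hw i (by simp)
    set π : ℝ := (w.map fun i => (a i / cum a n : ℝ)).prod with hπ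
    set Y : ℝ := a i / cum a n * π with hY
    have hprod : ((i :: w).map fun i => (a i / cum a n : ℝ)).prod = Y := by simp [hY, hπ]
    rw [hprod]
    set x : ℝ := U (i :: w) 0 1 with hx
    have hround : ∀ M : ℕ, 2 ^ K ≤ M → M < 2 ^ (K + 1) →
        M * Y + (M - (M / cum a n * cum a n : ℕ)) * (x - Y) ≤ S (i :: w) M := by
      intro M hM1 hM2
      have hQ : M / cum a n * cum a n ≤ M := Nat.div_mul_le_self _ _
      have hq : 0 < M / cum a n := Nat.div_pos (hmK.trans hM1) hm
      have h1 : S w (M / cum a n * a i) + (M - (M / cum a n * cum a n : ℕ)) * x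
          ≤ S (i :: w) M := by
        simp only [hS]
        rw [sum_range_split (a := a) (n := n) M]
        refine add_le_add ?_ ?_
        · rw [sum_range_mul]
          refine le_trans (Finset.sum_le_sum fun s hs => Finset.sum_le_sum fun y hy =>
            hout w M s i y hM1 hM2 (Finset.mem_range.1 hs) hi (Finset.mem_range.1 hy)) ?_
          exact Finset.single_le_sum (f := fun j => ∑ s ∈ Finset.range (M / cum a n),
            ∑ y ∈ Finset.range (a j), U (i :: w) (s * cum a n + (cum a j + y)) M)
            (fun j _ => Finset.sum_nonneg fun s _ => Finset.sum_nonneg fun y _ => hU _ _ _)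
            (Finset.mem_range.2 hi)
        · rw [← Nat.cast_sub hQ, ← nsmul_eq_mul, ← Nat.card_Ico, ← Finset.sum_const]
          refine Finset.sum_le_sum fun Z hZ => ?_
          rw [Finset.mem_Ico] at hZ
          exact hfail _ Z M hM1 hM2 hZ.2 ((Nat.le_div_iff_mul_le hm).2 hZ.1)
      have h2 : ((M / cum a n * cum a n : ℕ) : ℝ) * Y ≤ S w (M / cum a n * a i) := by
        have h3 : ((M / cum a n * cum a n : ℕ) : ℝ) * Y = (M / cum a n * a i : ℕ) * π := by
          rw [hY]
          push_cast
          field_simp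
        rw [h3]
        rcases Nat.eq_zero_or_pos (a i) with h0 | h0
        · simp [h0, hS]
        · have hai : a i ≤ cum a n := by
            have := cum_mono a (show i + 1 ≤ n from hi)
            have := cum_succ a i
            omega
          exact ih (M / cum a n * a i) (Nat.mul_pos hq h0)
            (((Nat.mul_le_mul_left _ hai).trans hQ).trans_lt hM2)
      linarith
    -- If `x` were less than `Y`, doubling would improve the bound on `x` by half of the defect.
    have hxY : Y ≤ x := by
      by_contra! hlt
      have h1 := le_of_doubling (S := fun M => -S (i :: w) M) (c := -(Y + (x - Y) / 2)) (κ := 0)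
        (hdouble (i :: w)) (fun M hM1 hM2 => by
          have h2 := hround M hM1 hM2
          have h3 := hkey M hM1 hM2
          have h4 : ((M : ℝ) - (M / cum a n * cum a n : ℕ)) * (Y - x) ≤ M / 2 * (Y - x) :=
            mul_le_mul_of_nonneg_right (by linarith) (by linarith)
          linarith) 1 one_pos (Nat.one_lt_two_pow (by omega))
      simp only [hS1] at h1
      simp at h1
      linarith
    intro M hM0 hM
    have := le_of_doubling (S := fun M => -S (i :: w) M) (c := -Y) (κ := 0)
      (hdouble (i :: w)) (fun M hM1 hM2 => by
        have h1 := hround M hM1 hM2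
        have h2 : ((M / cum a n * cum a n : ℕ) : ℝ) ≤ M := by
          exact_mod_cast Nat.div_mul_le_self M (cum a n)
        have h3 : 0 ≤ ((M : ℝ) - (M / cum a n * cum a n : ℕ)) * (x - Y) :=
          mul_nonneg (by linarith) (by linarith)
        linarith) M hM0 hM
    linarith

end

/-! ### Rounds of the main loop -/

/-- The run from `c` reaches `c'` after at least one step, without tossing a coin, within `κ` bit
operations and with `Safe` registers on the way. -/
def Moves (P : Program) (N B κ : ℕ) (c c' : Config) : Prop :=
  c'.tosses = c.tosses ∧ c'.ops ≤ c.ops + κ ∧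
    ∃ k, 0 < k ∧ ∀ ω, (∀ j < k, Safe N B ((step P ω)^[j] c).reg) ∧ (step P ω)^[k] c = c'

lemma Leads.exists_moves {P : Program} {N B x y pc : ℕ} {c : Config}
    {Q : ℕ → (ℕ →₀ ℕ) → List ℕ → Prop} (h : Leads P N B x y pc c.reg c.outputs Q)
    (hpc : c.pc = pc) :
    ∃ c', Moves P N B (x * (40 + 4 * B.size) + y * (40 + 4 * B.size + B.size * B.size)) c c' ∧
      Q c'.pc c'.reg c'.outputs := by
  subst hpc
  obtain ⟨k, pc', r', o', κ, hk, hκ, hq, h⟩ := h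
  exact ⟨⟨pc', r', c.tosses, c.ops + κ, o'⟩,
    ⟨rfl, Nat.add_le_add_left hκ _, k, hk, fun ω => h ω c.tosses c.ops⟩, hq⟩

/-- The machine is at the start of the main loop, with the values `Z` and `M`. -/
def AtHead (a : ℕ → ℕ) (n K Z M : ℕ) (c : Config) : Prop := c.pc = 1 ∧ Ready a n K Z M c.reg

/-- Bound for the bit operations of a round that tosses a coin, apart from the toss. -/
def tossCost (K : ℕ) : ℕ := 6 * (40 + 4 * (K + 2))

/-- Bound for the bit operations of a round that divides. -/
def divCost (K : ℕ) : ℕ :=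
  (8 * K + 19) * (40 + 4 * (K + 2)) + 5 * (40 + 4 * (K + 2) + (K + 2) * (K + 2))

section

variable {a : ℕ → ℕ} {n K Z M : ℕ} {c : Config}

lemma size_two_pow_succ (K : ℕ) : (2 ^ (K + 1)).size = K + 2 := Nat.size_pow

lemma Moves.mono {P : Program} {N B κ κ' : ℕ} {c c' : Config} (h : Moves P N B κ c c')
    (hκ : κ ≤ κ') : Moves P N B κ' c c' :=
  ⟨h.1, h.2.1.trans (Nat.add_le_add_left hκ _), h.2.2⟩

lemma AtHead.output {s i x : ℕ} (hn : 16 + n ≤ 2 ^ K) (hm : cum a n ≤ 2 ^ K) (hi : i < n)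
    (hx : x < a i) (hM : 2 ^ K ≤ M) (hs : s < M / cum a n)
    (hc : AtHead a n K (s * cum a n + (cum a i + x)) M c) :
    ∃ c', Moves (sampler a n K) (n + 1) (2 ^ (K + 1)) (divCost K) c c' ∧
      AtHead a n K (s * a i + x) (M / cum a n * a i) c' ∧ c'.outputs = c.outputs ++ [i] := by
  have h := leads_output (o := c.outputs) hn hm hi hx hM hs hc.2
  obtain ⟨c', h1, h2, h3, h4⟩ := h.exists_moves hc.1
  rw [size_two_pow_succ] at h1
  exact ⟨c', h1, ⟨h2, h3⟩, h4⟩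

lemma AtHead.fail (hm : cum a n ≤ 2 ^ K) (hM : 2 ^ K ≤ M) (h : M / cum a n ≤ Z / cum a n)
    (hc : AtHead a n K Z M c) :
    ∃ c', Moves (sampler a n K) (n + 1) (2 ^ (K + 1)) (divCost K) c c' ∧
      AtHead a n K 0 1 c' ∧ c'.outputs = c.outputs := by
  have h := leads_fail (o := c.outputs) hc.2 hm hM h
  obtain ⟨c', h1, h2, h3, h4⟩ := h.exists_moves hc.1
  rw [size_two_pow_succ] at h1
  refine ⟨c', h1.mono ?_, ⟨h2, h3⟩, h4⟩
  unfold divCost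
  gcongr <;> omega

lemma AtHead.toss (hZ : Z < M) (hM : M < 2 ^ K) (hc : AtHead a n K Z M c) :
    ∃ (c₁ : Config) (d : Bool → Config),
      Moves (sampler a n K) (n + 1) (2 ^ (K + 1)) (2 * (40 + 4 * (K + 2))) c c₁ ∧
      Safe (n + 1) (2 ^ (K + 1)) c₁.reg ∧ c₁.outputs = c.outputs ∧
      (∀ ω, step (sampler a n K) ω c₁ = d (ω c₁.tosses)) ∧
      ∀ b, (d b).tosses = c₁.tosses + 1 ∧ (d b).ops = c₁.ops + 5 ∧ (d b).outputs = c.outputs ∧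
        ∃ c₂, Moves (sampler a n K) (n + 1) (2 ^ (K + 1)) (4 * (40 + 4 * (K + 2))) (d b) c₂ ∧
          AtHead a n K (2 * Z + b.toNat) (2 * M) c₂ ∧ c₂.outputs = c.outputs := by
  have hB : 2 ^ (K + 1) = 2 * 2 ^ K := by ring
  have h := leads_toss (o := c.outputs) hc.2 hM
  obtain ⟨c₁, h1, hpc, hr, ho⟩ := h.exists_moves hc.1
  rw [size_two_pow_succ] at h1
  have hs3 : Nat.size 3 = 2 := by decide
  refine ⟨c₁, fun b => ⟨4, c₁.reg.update 3 b.toNat, c₁.tosses + 1, c₁.ops + 5, c₁.outputs⟩,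
    h1.mono (by omega), hr.safe, ho, ?_, ?_⟩
  · intro ω
    have hi : (sampler a n K)[c₁.pc]? = some (.toss 3) := by rw [hpc]; rfl
    rw [step, hi]
    simp [Instr.exec, Instr.cost, hpc, hs3]
  · intro b
    refine ⟨rfl, rfl, ho, ?_⟩
    have hb : b.toNat ≤ 1 := Bool.toNat_le b
    have hr2 : Ready a n K Z M (c₁.reg.update 3 b.toNat) := by
      refine ⟨?_, ?_, ?_, ?_, hr.safe.update (by omega) (hb.trans Nat.one_le_two_pow)⟩
      · simp [hr.reg_zero]
      · simp [hr.reg_one]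
      · simp [hr.reg_ten]
      · intro j hj
        simp [update_table, hr.table j hj]
    have h := leads_after_toss (o := c₁.outputs) hr2 (b := b.toNat) (by simp) hM (by omega)
    obtain ⟨c₂, h2, hpc2, hr3, ho2⟩ := Leads.exists_moves
      (c := ⟨4, c₁.reg.update 3 b.toNat, c₁.tosses + 1, c₁.ops + 5, c₁.outputs⟩) h rfl
    rw [size_two_pow_succ] at h2
    exact ⟨c₂, h2.mono (by omega), ⟨hpc2, hr3⟩, ho2.trans ho⟩

lemma exists_cum_add {ρ : ℕ} (h : ρ < cum a n) : ∃ i < n, ∃ x < a i, ρ = cum a i + x := by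
  induction n with
  | zero => simp [cum] at h
  | succ n ih =>
    rcases Nat.lt_or_ge ρ (cum a n) with hlt | hge
    · obtain ⟨i, hi, x, hx, h⟩ := ih hlt
      exact ⟨i, by omega, x, hx, h⟩
    · rw [cum_succ] at h
      exact ⟨n, by omega, ρ - cum a n, by omega, by omega⟩

/-! ### Memory -/

lemma Moves.safe {P : Program} {N B κ t : ℕ} {c c' : Config} {ω : ℕ → Bool}
    (h : Moves P N B κ c c') (hnext : ∀ t' < t, Safe N B ((step P ω)^[t'] c').reg) :
    Safe N B ((step P ω)^[t] c).reg := by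
  obtain ⟨-, -, k, hk, h⟩ := h
  rcases Nat.lt_or_ge t k with hlt | hge
  · exact (h ω).1 t hlt
  · obtain ⟨t', rfl⟩ := Nat.exists_eq_add_of_le' hge
    rw [Function.iterate_add_apply, (h ω).2]
    exact hnext t' (by omega)

lemma AtHead.safe (hm0 : 0 < cum a n) (hn : 16 + n ≤ 2 ^ K) (hm : cum a n ≤ 2 ^ K)
    (hc : AtHead a n K Z M c) (hZ : Z < M) (hM : M < 2 ^ (K + 1)) (ω : ℕ → Bool) (t : ℕ) :
    Safe (n + 1) (2 ^ (K + 1)) ((step (sampler a n K) ω)^[t] c).reg := by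
  have hB : 2 ^ (K + 1) = 2 * 2 ^ K := by ring
  induction t using Nat.strong_induction_on generalizing c Z M with
  | _ t ih =>
  rcases Nat.lt_or_ge M (2 ^ K) with hlt | hge
  · obtain ⟨c₁, d, h1, hs, -, hd, h2⟩ := hc.toss hZ hlt
    refine h1.safe fun t' ht' => ?_
    rcases t' with _ | t'
    · exact hs
    · rw [Function.iterate_succ_apply, hd]
      obtain ⟨-, -, -, c₂, h3, h4, -⟩ := h2 (ω c₁.tosses)
      have hb : (ω c₁.tosses).toNat ≤ 1 := Bool.toNat_le _
      exact h3.safe fun t'' ht'' => ih t'' (by omega) h4 (by omega) (by omega)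
  · rcases Nat.lt_or_ge (Z / cum a n) (M / cum a n) with h | h
    · obtain ⟨i, hi, x, hx, hρ⟩ := exists_cum_add (Nat.mod_lt Z hm0)
      have hZ' : Z = Z / cum a n * cum a n + (cum a i + x) := by
        rw [← hρ, mul_comm, Nat.div_add_mod]
      rw [hZ'] at hc
      obtain ⟨c', h1, h2, -⟩ := hc.output hn hm hi hx hge h
      have hai : a i ≤ cum a n := by
        have := cum_mono a (show i + 1 ≤ n from hi)
        have := cum_succ a i
        omega
      refine h1.safe fun t' ht' => ih t' ht' h2 ?_
        (((Nat.mul_le_mul_left _ hai).trans (Nat.div_mul_le_self _ _)).trans_lt hM)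
      calc Z / cum a n * a i + x < (Z / cum a n + 1) * a i := by rw [Nat.succ_mul]; omega
        _ ≤ M / cum a n * a i := Nat.mul_le_mul_right _ h
    · obtain ⟨c', h1, h2, -⟩ := hc.fail hm hge h
      exact h1.safe fun t' ht' => ih t' ht' h2 one_pos (Nat.one_lt_two_pow (by omega))

lemma init_moves (hm : cum a n ≤ 2 ^ K) :
    ∃ κ c, Moves (sampler a n K) (n + 1) (2 ^ (K + 1)) κ Config.init c ∧
      AtHead a n K 0 1 c ∧ c.outputs = [] := by
  obtain ⟨x, hx⟩ := leads_init (a := a) (n := n) hm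
  obtain ⟨c, h1, h2, h3, h4⟩ := Leads.exists_moves (c := Config.init) hx rfl
  exact ⟨_, c, h1, ⟨h2, h3⟩, h4⟩

lemma safe_run (hm0 : 0 < cum a n) (hn : 16 + n ≤ 2 ^ K) (hm : cum a n ≤ 2 ^ K)
    (ω : ℕ → Bool) (t : ℕ) :
    Safe (n + 1) (2 ^ (K + 1)) (run (sampler a n K) ω t).reg := by
  obtain ⟨κ, c, h1, h2, -⟩ := init_moves (a := a) hm
  exact h1.safe fun t' _ => h2.safe hm0 hn hm one_pos (Nat.one_lt_two_pow (by omega)) ω t'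

lemma Safe.dataBits_le (hn : 16 + n ≤ 2 ^ K) (h : Safe (n + 1) (2 ^ (K + 1)) c.reg) :
    c.dataBits ≤ (17 + n) * (2 * K + 3) := by
  have hB : 2 ^ (K + 1) = 2 * 2 ^ K := by ring
  have hsub : c.reg.support ⊆ Finset.range (17 + n) := by
    intro i hi
    rw [Finset.mem_range]
    by_contra hlt
    exact Finsupp.mem_support_iff.1 hi ((h i).2 (by omega))
  calc c.dataBits ≤ ∑ i ∈ Finset.range (17 + n), (i.size + (c.reg i).size) :=
        Finset.sum_le_sum_of_subset hsub
    _ ≤ ∑ _i ∈ Finset.range (17 + n), (2 * K + 3) := by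
        refine Finset.sum_le_sum fun i hi => ?_
        rw [Finset.mem_range] at hi
        have h1 : i.size ≤ K + 1 := Nat.size_le.2 (by omega)
        have h2 := h.size_le i
        rw [size_two_pow_succ] at h2
        omega
    _ = _ := by simp

lemma bits_sampler_le (hn : 16 + n ≤ 2 ^ K) (hm : cum a n ≤ 2 ^ K) :
    (sampler a n K).bits ≤ (41 + n) * (2 * K + 20) := by
  have h : ∀ i ∈ sampler a n K, i.bits ≤ 2 * K + 20 := by
    have hB : 2 ^ (K + 1) = 2 * 2 ^ K := by ring
    have h1 : (2 ^ K).size = K + 1 := Nat.size_pow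
    have h2 : (cum a n).size ≤ K + 1 := Nat.size_le.2 (by omega)
    have h3 : (16 + n).size ≤ K + 1 := Nat.size_le.2 (by omega)
    intro i hi
    rcases List.mem_append.1 hi with hi | hi
    · simp only [mainLoop, List.mem_cons, List.not_mem_nil, or_false] at hi
      have hs : ∀ k < 64, Nat.size k ≤ 6 := fun k hk => size_le_six hk
      rcases hi with rfl | rfl | rfl | rfl | rfl | rfl | rfl | rfl | rfl | rfl | rfl | rfl | rfl |
        rfl | rfl | rfl | rfl | rfl | rfl | rfl | rfl | rfl | rfl | rfl | rfl | rfl | rfl | rfl |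
        rfl | rfl | rfl | rfl | rfl | rfl | rfl | rfl | rfl | rfl | rfl <;>
      · simp only [Instr.bits]
        have := hs 0 (by norm_num)
        have := hs 1 (by norm_num)
        have := hs 2 (by norm_num)
        have := hs 3 (by norm_num)
        have := hs 4 (by norm_num)
        have := hs 5 (by norm_num)
        have := hs 6 (by norm_num)
        have := hs 7 (by norm_num)
        have := hs 8 (by norm_num)
        have := hs 9 (by norm_num)
        have := hs 10 (by norm_num)
        have := hs 15 (by norm_num)
        have := hs 16 (by norm_num)
        have := hs 23 (by norm_num)
        have := hs 25 (by norm_num)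
        have := hs 36 (by norm_num)
        have := hs 39 (by norm_num)
        omega
    · rcases List.mem_append.1 hi with hi | hi
      · obtain ⟨j, hj, rfl⟩ := List.mem_map.1 hi
        rw [List.mem_range] at hj
        have h4 : (16 + j).size ≤ K + 1 := Nat.size_le.2 (by omega)
        have h5 : (cum a j).size ≤ K + 1 :=
          Nat.size_le.2 (by have := cum_mono a (show j ≤ n by omega); omega)
        simp only [Instr.bits]
        omega
      · rw [List.mem_singleton] at hi
        subst hi
        have h6 : Nat.size 36 ≤ 6 := size_le_six (by norm_num)
        simp only [Instr.bits, Nat.size_zero]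
        omega
  have h2 := List.sum_le_card_nsmul ((sampler a n K).map Instr.bits) (2 * K + 20) (by
    intro b hb
    obtain ⟨i, hi, rfl⟩ := List.mem_map.1 hb
    exact h i hi)
  have h3 : (sampler a n K).length = 41 + n := by
    simp [sampler, mainLoop, tableInit]
    omega
  rw [List.length_map, h3, smul_eq_mul] at h2
  exact h2

end

/-! ### Expected cost -/

/-- A linear combination of the two counters. -/
def weighted (α β : ℕ) (c : Config) : ℕ := α * c.tosses + β * c.ops

lemma Moves.lintegral_restCost_le {P : Program} {N B κ α β R T : ℕ} {c c' : Config}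
    (h : Moves P N B κ c c') :
    ∫⁻ ω, restCost R (weighted α β) P T c ω ∂fairCoins ≤
      (β * κ : ℕ) + ∫⁻ ω, restCost R (weighted α β) P T c' ω ∂fairCoins := by
  obtain ⟨h1, h2, k, -, h3⟩ := h
  calc ∫⁻ ω, restCost R (weighted α β) P T c ω ∂fairCoins
      ≤ ∫⁻ ω, ((β * κ : ℕ) + restCost R (weighted α β) P T c' ω) ∂fairCoins :=
        lintegral_mono fun ω => restCost_le_add (h3 ω).2 (by
          unfold weighted
          rw [h1, add_assoc, ← Nat.mul_add]
          gcongr)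
    _ = _ := by rw [lintegral_add_left measurable_const]; simp

/-- The largest expected cost until `k` more outputs, truncated at `R`, from the start of the main
loop with the values `Z` and `M`. -/
noncomputable def expCost (R α β : ℕ) (a : ℕ → ℕ) (n K k Z M : ℕ) : ℝ≥0∞ :=
  ⨆ (c : Config) (_ : AtHead a n K Z M c) (T : ℕ) (_ : T ≤ c.outputs.length + k),
    ∫⁻ ω, restCost R (weighted α β) (sampler a n K) T c ω ∂fairCoins

/-- The least probability of the outputs `w`, from the start of the main loop with the values `Z`
and `M`. The bound by `1` matters only where no such state exists. -/
noncomputable def wordProb (a : ℕ → ℕ) (n K : ℕ) (w : List ℕ) (Z M : ℕ) : ℝ≥0∞ :=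
  min 1 (⨅ (c : Config) (_ : AtHead a n K Z M c), fairCoins (outputsWord (sampler a n K) w c))

section

variable {R α β : ℕ} {a : ℕ → ℕ} {n K k Z M : ℕ} {c : Config}

lemma le_expCost {T : ℕ} (hc : AtHead a n K Z M c) (hT : T ≤ c.outputs.length + k) :
    ∫⁻ ω, restCost R (weighted α β) (sampler a n K) T c ω ∂fairCoins
      ≤ expCost R α β a n K k Z M :=
  le_iSup₂_of_le c hc (le_iSup₂_of_le T hT le_rfl)

lemma expCost_le_of_forall {x : ℝ≥0∞} (h : ∀ c T, AtHead a n K Z M c →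
    T ≤ c.outputs.length + k →
    ∫⁻ ω, restCost R (weighted α β) (sampler a n K) T c ω ∂fairCoins ≤ x) :
    expCost R α β a n K k Z M ≤ x :=
  iSup₂_le fun c hc => iSup₂_le fun T hT => h c T hc hT

lemma expCost_ne_top : expCost R α β a n K k Z M ≠ ∞ := by
  refine ne_top_of_le_ne_top (ENNReal.natCast_ne_top R) (expCost_le_of_forall fun c T _ _ => ?_)
  calc ∫⁻ ω, restCost R (weighted α β) (sampler a n K) T c ω ∂fairCoins
      ≤ ∫⁻ _, (R : ℝ≥0∞) ∂fairCoins := lintegral_mono fun ω => min_le_right _ _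
    _ = R := by simp

lemma expCost_zero : expCost R α β a n K 0 Z M = 0 := by
  refine le_antisymm (expCost_le_of_forall fun c T _ hT => ?_) zero_le
  rw [lintegral_congr fun ω => restCost_eq_zero hT ω]
  simp

lemma expCost_toss (hZ : Z < M) (hM : M < 2 ^ K) :
    expCost R α β a n K k Z M ≤ ((α + β * (tossCost K + 5) : ℕ) : ℝ≥0∞) +
      (expCost R α β a n K k (2 * Z) (2 * M) + expCost R α β a n K k (2 * Z + 1) (2 * M)) / 2 := by
  refine expCost_le_of_forall fun c T hc hT => ?_
  obtain ⟨c₁, d, h1, -, -, hd, h2⟩ := hc.toss hZ hM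
  have hb : ∀ b : Bool, ∫⁻ ω, restCost R (weighted α β) (sampler a n K) T (d b) ω ∂fairCoins ≤
      ((β * (4 * (40 + 4 * (K + 2))) : ℕ) : ℝ≥0∞) +
        expCost R α β a n K k (2 * Z + b.toNat) (2 * M) := by
    intro b
    obtain ⟨-, -, -, c₂, h3, h4, h5⟩ := h2 b
    refine h3.lintegral_restCost_le.trans (add_le_add le_rfl (le_expCost h4 ?_))
    rw [h5]
    exact hT
  refine h1.lintegral_restCost_le.trans ?_
  refine (add_le_add le_rfl (lintegral_restCost_toss (κ := α + β * 5) hd (fun b => (h2 b).1)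
    fun b => ?_)).trans ?_
  · unfold weighted
    rw [(h2 b).1, (h2 b).2.1]
    exact le_of_eq (by ring)
  · refine (add_le_add le_rfl (add_le_add le_rfl (ENNReal.div_le_div_right
      (add_le_add (hb false) (hb true)) 2))).trans (le_of_eq ?_)
    simp only [Bool.toNat_false, Bool.toNat_true, add_zero]
    generalize expCost R α β a n K k (2 * Z) (2 * M) = e₁
    generalize expCost R α β a n K k (2 * Z + 1) (2 * M) = e₂
    rw [add_add_add_comm, ENNReal.add_div, ← two_mul, mul_comm (2 : ℝ≥0∞),
      ENNReal.mul_div_cancel_right (by simp) (by simp)]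
    rw [← add_assoc, ← add_assoc, ← Nat.cast_add, ← Nat.cast_add]
    congr 2
    unfold tossCost
    ring

lemma expCost_output {s i x : ℕ} (hn : 16 + n ≤ 2 ^ K) (hm : cum a n ≤ 2 ^ K) (hi : i < n)
    (hx : x < a i) (hM : 2 ^ K ≤ M) (hs : s < M / cum a n) :
    expCost R α β a n K (k + 1) (s * cum a n + (cum a i + x)) M ≤
      ((β * divCost K : ℕ) : ℝ≥0∞) + expCost R α β a n K k (s * a i + x) (M / cum a n * a i) := by
  refine expCost_le_of_forall fun c T hc hT => ?_
  obtain ⟨c', h1, h2, h3⟩ := hc.output hn hm hi hx hM hs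
  refine h1.lintegral_restCost_le.trans (add_le_add le_rfl (le_expCost h2 ?_))
  simp [h3]
  omega

lemma expCost_fail (hm : cum a n ≤ 2 ^ K) (hM : 2 ^ K ≤ M) (h : M / cum a n ≤ Z / cum a n) :
    expCost R α β a n K k Z M ≤ ((β * divCost K : ℕ) : ℝ≥0∞) + expCost R α β a n K k 0 1 := by
  refine expCost_le_of_forall fun c T hc hT => ?_
  obtain ⟨c', h1, h2, h3⟩ := hc.fail hm hM h
  refine h1.lintegral_restCost_le.trans (add_le_add le_rfl (le_expCost h2 ?_))
  rwa [h3]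

lemma toReal_le_natCast_add {x y : ℝ≥0∞} {N : ℕ} (h : x ≤ N + y) (hy : y ≠ ∞) :
    x.toReal ≤ N + y.toReal := by
  have := ENNReal.toReal_mono (ENNReal.add_ne_top.2 ⟨ENNReal.natCast_ne_top N, hy⟩) h
  rwa [ENNReal.toReal_add (ENNReal.natCast_ne_top N) hy, ENNReal.toReal_natCast] at this

/-- The division by `m` loses little for all `M` in use: with `Q = M / m * m`, the output fails with
probability `(M - Q) / M ≤ 1 / 2`, and the expected loss of bits due to `M - Q`, which is
`(M - Q) / M * logb 2 M` by the reset and `Q / M * logb 2 (M / Q)` by the output, is at most `ε`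
times the probability `Q / M` of an output. -/
def SmallLoss (m K : ℕ) (ε : ℝ) : Prop :=
  ∀ M : ℕ, 2 ^ K ≤ M → M < 2 ^ (K + 1) → (M : ℝ) ≤ 2 * (M / m * m : ℕ) ∧
    M * Real.logb 2 M - (M / m * m : ℕ) * Real.logb 2 (M / m * m : ℕ) ≤ (M / m * m : ℕ) * ε

/-- The expected cost of `T` outputs. -/
lemma exists_lintegral_costUntil_le {ε : ℝ} (α β : ℕ) (hm0 : 0 < cum a n)
    (hn : 16 + n ≤ 2 ^ K) (hm : cum a n ≤ 2 ^ K) (hloss : SmallLoss (cum a n) K ε) :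
    ∃ A : ℝ≥0∞, A ≠ ∞ ∧ ∀ T : ℕ,
      ∫⁻ ω, costUntil (weighted α β) (sampler a n K) T Config.init ω ∂fairCoins ≤
        A + ENNReal.ofReal
          (((α + β * (tossCost K + 5) : ℕ) * (weightEntropy a n + ε)
            + 2 * (β * divCost K : ℕ)) * T + (α + β * (tossCost K + 5) : ℕ) * (K + 1)) := by
  obtain ⟨κ, c, h1, h2, h3⟩ := init_moves (a := a) hm
  refine ⟨weighted α β c, ENNReal.natCast_ne_top _, fun T => ?_⟩
  set P := sampler a n K with hP
  set f := weighted α β with hf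
  set b : ℝ := ((α + β * (tossCost K + 5) : ℕ) * (weightEntropy a n + ε)
            + 2 * (β * divCost K : ℕ)) * T + (α + β * (tossCost K + 5) : ℕ) * (K + 1) with hb
  have hV : ∀ R : ℕ, (expCost R α β a n K T 0 1).toReal ≤ b := by
    intro R
    refine cost_le (V := fun k Z M => (expCost R α β a n K k Z M).toReal) (by positivity)
      (by positivity) hm0 hm hloss ?_ ?_ ?_ ?_ T
    · intro Z M
      simp [expCost_zero]
    · intro k Z M hZ hM
      have h := toReal_le_natCast_add (expCost_toss (R := R) (α := α) (β := β)
        (a := a) (n := n) (k := k) hZ hM) (by simp [ENNReal.div_eq_top, expCost_ne_top])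
      rw [ENNReal.toReal_div, ENNReal.toReal_add expCost_ne_top expCost_ne_top] at h
      simpa using h
    · intro k M s i x hM _ hs hi hx
      exact toReal_le_natCast_add (expCost_output hn hm hi hx hM hs) expCost_ne_top
    · intro k Z M hM _ _ hZM
      exact toReal_le_natCast_add (expCost_fail hm hM hZM) expCost_ne_top
  have hR : ∀ R : ℕ, ∫⁻ ω, restCost R f P T c ω ∂fairCoins ≤ ENNReal.ofReal b := by
    intro R
    refine (le_expCost h2 (by omega : T ≤ c.outputs.length + T)).trans ?_
    exact ENNReal.le_ofReal_iff_toReal_le expCost_ne_top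
      (ENNReal.toReal_nonneg.trans (hV R)) |>.2 (hV R)
  have hsup : ∀ ω, costUntil f P T c ω - f c = ⨆ R : ℕ, restCost R f P T c ω := by
    intro ω
    have h : costUntil f P T c ω - f c = (costUntil f P T c ω - f c) ⊓ ⨆ R : ℕ, (R : ℝ≥0∞) := by
      rw [ENNReal.iSup_natCast]
      simp
    rw [h, inf_iSup_eq]
    rfl
  obtain ⟨-, -, k, -, h4⟩ := h1
  calc ∫⁻ ω, costUntil f P T Config.init ω ∂fairCoins
      ≤ ∫⁻ ω, (f c + (costUntil f P T c ω - f c)) ∂fairCoins := by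
        refine lintegral_mono fun ω => ?_
        refine (costUntil_le_iterate f P T k Config.init ω).trans ?_
        rw [(h4 ω).2]
        exact le_add_tsub
    _ = f c + ∫⁻ ω, ⨆ R : ℕ, restCost R f P T c ω ∂fairCoins := by
        rw [lintegral_add_left measurable_const]
        simp [hsup]
    _ ≤ f c + ENNReal.ofReal b := by
        gcongr
        rw [lintegral_iSup (fun R => measurable_restCost f P T R c)]
        · exact iSup_le hR
        · intro R R' hRR ω
          exact min_le_min le_rfl (by exact_mod_cast hRR)

lemma limsup_div_le {f : ℕ → ℝ≥0∞} {A : ℝ≥0∞} {r b : ℝ} (hA : A ≠ ∞) (hr : 0 ≤ r) (hb : 0 ≤ b)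
    (h : ∀ T, f T ≤ A + ENNReal.ofReal (r * T + b)) :
    limsup (fun T : ℕ => f T / T) atTop ≤ ENNReal.ofReal r := by
  have hle : ∀ᶠ T : ℕ in atTop, f T / T ≤ (A + ENNReal.ofReal b) / T + ENNReal.ofReal r := by
    filter_upwards [eventually_gt_atTop 0] with T hT
    have hT0 : (T : ℝ≥0∞) ≠ 0 := by exact_mod_cast hT.ne'
    calc f T / T ≤ (A + ENNReal.ofReal (r * T + b)) / T := ENNReal.div_le_div_right (h T) _
      _ = (A + ENNReal.ofReal b + ENNReal.ofReal r * T) / T := by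
        rw [ENNReal.ofReal_add (by positivity) hb, ENNReal.ofReal_mul hr, ENNReal.ofReal_natCast]
        rw [add_assoc, add_comm (ENNReal.ofReal b)]
      _ = _ := by
        rw [ENNReal.add_div, ENNReal.mul_div_cancel_right hT0 (ENNReal.natCast_ne_top T)]
  have hlim : Tendsto (fun T : ℕ => (A + ENNReal.ofReal b) / T + ENNReal.ofReal r) atTop
      (nhds (0 + ENNReal.ofReal r)) := by
    refine Tendsto.add ?_ tendsto_const_nhds
    have := ENNReal.Tendsto.const_div (a := A + ENNReal.ofReal b) ENNReal.tendsto_nat_nhds_top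
      (Or.inr (by simp [hA]))
    simpa using this
  rw [zero_add] at hlim
  exact (limsup_le_limsup hle).trans hlim.limsup_eq.le

/-! ### Law of the outputs -/

lemma wordProb_le {w : List ℕ} (hc : AtHead a n K Z M c) :
    wordProb a n K w Z M ≤ fairCoins (outputsWord (sampler a n K) w c) :=
  (min_le_right _ _).trans (iInf₂_le c hc)

lemma le_wordProb {w : List ℕ} {x : ℝ≥0∞} (h1 : x ≤ 1)
    (h : ∀ c, AtHead a n K Z M c → x ≤ fairCoins (outputsWord (sampler a n K) w c)) :
    x ≤ wordProb a n K w Z M :=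
  le_min h1 (le_iInf₂ h)

lemma wordProb_le_one {w : List ℕ} : wordProb a n K w Z M ≤ 1 := min_le_left _ _

lemma wordProb_ne_top {w : List ℕ} : wordProb a n K w Z M ≠ ∞ :=
  ne_top_of_le_ne_top ENNReal.one_ne_top wordProb_le_one

lemma Moves.measure_outputsWord_le {P : Program} {N B κ : ℕ} {c c' : Config} {v w : List ℕ}
    (h : Moves P N B κ c c') (ho : c'.outputs = c.outputs ++ v) :
    fairCoins (outputsWord P w c') ≤ fairCoins (outputsWord P (v ++ w) c) := by
  obtain ⟨-, -, k, -, h⟩ := h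
  exact measure_mono fun ω hω => mem_outputsWord_of_iterate (h ω).2 ho hω

lemma wordProb_toss {w : List ℕ} (hZ : Z < M) (hM : M < 2 ^ K) :
    (wordProb a n K w (2 * Z) (2 * M) + wordProb a n K w (2 * Z + 1) (2 * M)) / 2
      ≤ wordProb a n K w Z M := by
  refine le_wordProb ?_ fun c hc => ?_
  · refine (ENNReal.div_le_div_right (add_le_add wordProb_le_one wordProb_le_one) 2).trans ?_
    rw [one_add_one_eq_two, ENNReal.div_self (by simp) (by simp)]
  · obtain ⟨c₁, d, h1, -, ho, hd, h2⟩ := hc.toss hZ hM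
    have hb : ∀ b : Bool, wordProb a n K w (2 * Z + b.toNat) (2 * M) ≤
        fairCoins (outputsWord (sampler a n K) w (d b)) := by
      intro b
      obtain ⟨-, -, ho', c₂, h3, h4, h5⟩ := h2 b
      exact (wordProb_le h4).trans
        (h3.measure_outputsWord_le (v := []) (by rw [h5, ho', List.append_nil]))
    calc _ ≤ _ := ENNReal.div_le_div_right (add_le_add (hb false) (hb true)) 2
      _ ≤ fairCoins (outputsWord (sampler a n K) w c₁) :=
        measure_outputsWord_toss hd (fun b => (h2 b).1) fun b => (h2 b).2.2.1.trans ho.symm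
      _ ≤ _ := h1.measure_outputsWord_le (v := []) (by rw [ho, List.append_nil])

/-- The first outputs are a given word at least as often as they should be. -/
lemma prod_le_measure_outputsWord {ε : ℝ} (hm0 : 0 < cum a n) (hn : 16 + n ≤ 2 ^ K)
    (hm : cum a n ≤ 2 ^ K) (hloss : SmallLoss (cum a n) K ε) (w : List ℕ)
    (hw : ∀ i ∈ w, i < n) :
    ENNReal.ofReal (w.map fun i => (a i / cum a n : ℝ)).prod ≤
      fairCoins (outputsWord (sampler a n K) w Config.init) := by
  obtain ⟨κ, c, h1, h2, h3⟩ := init_moves (a := a) hm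
  refine le_trans ?_ ((wordProb_le h2).trans (h1.measure_outputsWord_le (v := []) h3))
  rw [ENNReal.ofReal_le_iff_le_toReal wordProb_ne_top]
  refine prod_le_prob (U := fun w Z M => (wordProb a n K w Z M).toReal) hm0 hm
    (fun M hM hM' => (hloss M hM hM').1) (fun _ _ _ => ENNReal.toReal_nonneg) ?_ ?_ ?_ ?_ w hw
  · intro Z M
    have h := ENNReal.toReal_mono wordProb_ne_top
      (le_wordProb (a := a) (n := n) (K := K) (Z := Z) (M := M) (w := []) le_rfl fun c _ => by
        rw [outputsWord_nil, measure_univ])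
    simpa using h
  · intro w Z M hZ hM
    have h := ENNReal.toReal_mono wordProb_ne_top
      (wordProb_toss (a := a) (n := n) (w := w) hZ hM)
    rw [ENNReal.toReal_div, ENNReal.toReal_add wordProb_ne_top wordProb_ne_top] at h
    simpa using h
  · intro w M s i x hM _ hs hi hx
    refine ENNReal.toReal_mono wordProb_ne_top (le_wordProb wordProb_le_one fun c hc => ?_)
    obtain ⟨c', h1, h2, h3⟩ := hc.output hn hm hi hx hM hs
    exact (wordProb_le h2).trans (h1.measure_outputsWord_le (v := [i]) h3)
  · intro w Z M hM _ _ hZM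
    refine ENNReal.toReal_mono wordProb_ne_top (le_wordProb wordProb_le_one fun c hc => ?_)
    obtain ⟨c', h1, h2, h3⟩ := hc.fail hm hM hZM
    exact (wordProb_le h2).trans
      (h1.measure_outputsWord_le (v := []) (by rw [h3, List.append_nil]))

lemma setOf_outputs_eq (P : Program) {n T : ℕ} (w : Fin T → Fin n) :
    {ω | ∃ t, ∀ k : Fin T, (run P ω t).outputs[(k : ℕ)]? = some (w k : ℕ)} =
      outputsWord P (List.ofFn fun k => (w k : ℕ)) Config.init := by
  ext ω
  refine exists_congr fun t => ?_
  rw [show Config.init.outputs = [] from rfl, List.nil_append, List.prefix_iff_getElem?]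
  constructor
  · intro h k hk
    rw [List.length_ofFn] at hk
    simpa [run] using h ⟨k, hk⟩
  · intro h k
    simpa [run] using h k (by simp)

/-- The probabilities of the words of a given length add up to at most `1`, hence lower bounds that
add up to `1` are the exact values. -/
lemma samples_of_le {P : Program} {p : Fin n → ℝ} (hp : p ∈ stdSimplex ℝ (Fin n))
    (h : ∀ (T : ℕ) (w : Fin T → Fin n), ENNReal.ofReal (∏ k, p (w k)) ≤
      fairCoins (outputsWord P (List.ofFn fun k => (w k : ℕ)) Config.init)) : Samples P p := by
  intro T w
  rw [setOf_outputs_eq]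
  set E : (Fin T → Fin n) → Set (ℕ → Bool) :=
    fun w => outputsWord P (List.ofFn fun k => (w k : ℕ)) Config.init with hE
  have hdisj : Pairwise (Function.onFun Disjoint E) := by
    intro v w hvw
    rw [Function.onFun, Set.disjoint_left]
    rintro ω ⟨s, hs⟩ ⟨t, ht⟩
    apply hvw
    have hpre : ∀ {x y}, x ≤ y → (run P ω x).outputs <+: (run P ω y).outputs :=
      fun h => outputs_prefix_iterate P ω Config.init h
    have hs' := hs.trans (hpre (le_max_left s t))
    have ht' := ht.trans (hpre (le_max_right s t))
    have := (List.prefix_of_prefix_length_le hs' ht' (by simp)).eq_of_length (by simp)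
    rw [List.append_cancel_left_eq, List.ofFn_inj] at this
    funext k
    exact Fin.ext (congrFun this k)
  have hsum : ∑ v, fairCoins (E v) ≤ 1 := by
    rw [← tsum_fintype (L := .unconditional _),
      ← measure_iUnion hdisj fun v => measurableSet_outputsWord _]
    exact prob_le_one
  have hone : ∑ v : Fin T → Fin n, ENNReal.ofReal (∏ k, p (v k)) = 1 := by
    rw [← ENNReal.ofReal_sum_of_nonneg fun v _ => Finset.prod_nonneg fun k _ => hp.1 _]
    have : ∑ v : Fin T → Fin n, ∏ k, p (v k) = ∏ _k : Fin T, ∑ i, p i := by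
      rw [Finset.prod_univ_sum, Fintype.piFinset_univ]
    rw [this, hp.2]
    simp
  refine le_antisymm ?_ (h T w)
  rw [← Finset.add_sum_erase _ _ (Finset.mem_univ w)] at hsum hone
  have hle : ∑ v ∈ Finset.univ.erase w, ENNReal.ofReal (∏ k, p (v k))
      ≤ ∑ v ∈ Finset.univ.erase w, fairCoins (E v) := Finset.sum_le_sum fun v _ => h T v
  have hfin : ∑ v ∈ Finset.univ.erase w, ENNReal.ofReal (∏ k, p (v k)) ≠ ∞ :=
    ENNReal.sum_ne_top.2 fun _ _ => ENNReal.ofReal_ne_top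
  rw [← ENNReal.add_le_add_iff_right hfin, hone]
  exact (add_le_add le_rfl hle).trans hsum

end

/-! ### Choice of the size of `M` -/

section

variable {a : ℕ → ℕ} {n : ℕ}

lemma smallLoss_of_le {m L : ℕ} {ε : ℝ} (hm : 0 < m) (hε1 : ε ≤ 1)
    (h : (m : ℝ) ≤ ε * 2 ^ L) : SmallLoss m (2 * L + 10) ε := by
  intro M hM1 hM2
  have hL : ∀ L : ℕ, 2 * L + 13 ≤ 2 ^ (L + 9) := by
    intro L
    induction L with
    | zero => norm_num
    | succ L ih => rw [show L + 1 + 9 = (L + 9) + 1 by ring, pow_succ]; omega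
  have hL' : (2 * L + 13 : ℝ) ≤ 2 ^ (L + 9) := by exact_mod_cast hL L
  have hM0 : 0 < M := (Nat.two_pow_pos _).trans_le hM1
  have hlog : Real.logb 2 M ≤ (2 * L + 10 : ℕ) + 1 := logb_two_natCast_le hM0 hM2
  have hM1' : (2 : ℝ) ^ (2 * L + 10) ≤ M := by exact_mod_cast hM1
  have hpow : (2 : ℝ) ^ (2 * L + 10) = 2 * (2 ^ L * 2 ^ (L + 9)) := by
    rw [← pow_add, ← pow_succ']
    congr 1
    ring
  -- The remainder `r` is less than `m`, a fraction `ε / (2 * L + 13)` of half of `M` at most.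
  obtain ⟨Q, hQ⟩ : ∃ Q, Q = M / m * m := ⟨_, rfl⟩
  rw [← hQ]
  have hQM : (M : ℝ) = Q + (M % m : ℕ) := by
    rw [hQ, ← Nat.cast_add, mul_comm, Nat.div_add_mod]
  have hr : ((M % m : ℕ) : ℝ) ≤ m := by exact_mod_cast (Nat.mod_lt M hm).le
  set r : ℝ := ((M % m : ℕ) : ℝ) with hrdef
  have hr0 : 0 ≤ r := by positivity
  have hmp : (m : ℝ) * (2 * L + 13) ≤ ε * (2 ^ L * 2 ^ (L + 9)) := by
    calc (m : ℝ) * (2 * L + 13) ≤ (ε * 2 ^ L) * 2 ^ (L + 9) :=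
          mul_le_mul h hL' (by positivity) (le_trans (by positivity) h)
      _ = _ := by ring
  have hA : (0 : ℝ) < 2 ^ L * 2 ^ (L + 9) := by positivity
  have h1 : (m : ℝ) ≤ m * (2 * L + 13) := by
    have : (0 : ℝ) ≤ m * (2 * L + 12) := by positivity
    linarith
  have h2 : (m : ℝ) ≤ 2 ^ L * 2 ^ (L + 9) := by
    have := mul_le_mul_of_nonneg_right hε1 hA.le
    linarith
  have hMQ : (M : ℝ) ≤ 2 * Q := by linarith
  refine ⟨hMQ, ?_⟩
  have hQ0 : (0 : ℝ) < Q := by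
    have : (0 : ℝ) < M := by exact_mod_cast hM0
    linarith
  have hε0 : 0 ≤ ε := by
    by_contra! hlt
    have : ε * 2 ^ L ≤ 0 := mul_nonpos_of_nonpos_of_nonneg hlt.le (by positivity)
    have : (0 : ℝ) < m := by exact_mod_cast hm
    linarith
  have hl2 := Real.log_two_gt_d9
  have h3 : Q * (Real.logb 2 M - Real.logb 2 Q) ≤ 2 * r := by
    rw [← Real.logb_div (by positivity) hQ0.ne', Real.logb, mul_div_assoc',
      div_le_iff₀ (by linarith)]
    have h4 := Real.log_le_sub_one_of_pos (show (0 : ℝ) < M / Q by positivity)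
    have h5 : Q * Real.log (M / Q) ≤ Q * (M / Q - 1) := mul_le_mul_of_nonneg_left h4 hQ0.le
    have h6 : (Q : ℝ) * (M / Q - 1) = r := by
      field_simp
      linarith
    nlinarith
  have h4 : r * Real.logb 2 M ≤ r * ((2 * L + 10 : ℕ) + 1) := mul_le_mul_of_nonneg_left hlog hr0
  have h5 : r * (2 * L + 13) ≤ m * (2 * L + 13) := mul_le_mul_of_nonneg_right hr (by positivity)
  have h6 : ε * (2 ^ L * 2 ^ (L + 9)) ≤ ε * Q := mul_le_mul_of_nonneg_left (by linarith) hε0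
  push_cast at h4
  calc M * Real.logb 2 M - Q * Real.logb 2 Q
      = r * Real.logb 2 M + Q * (Real.logb 2 M - Real.logb 2 Q) := by rw [hQM]; ring
    _ ≤ Q * ε := by linarith

lemma weight_le_cum {i : ℕ} (hi : i < n) : a i ≤ cum a n := by
  have := cum_mono a (show i + 1 ≤ n from hi)
  have := cum_succ a i
  omega

lemma weightEntropy_nonneg (a : ℕ → ℕ) (n : ℕ) : 0 ≤ weightEntropy a n := by
  rw [weightEntropy, neg_nonneg]
  refine Finset.sum_nonpos fun i hi => ?_
  have h : (a i : ℝ) ≤ cum a n := by exact_mod_cast weight_le_cum (Finset.mem_range.1 hi)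
  exact mul_nonpos_of_nonneg_of_nonpos (by positivity)
    (Real.logb_nonpos (by norm_num) (by positivity) (div_le_one_of_le₀ h (by positivity)))

lemma weightEntropy_le {K : ℕ} (hm0 : 0 < cum a n) (hm : cum a n < 2 ^ (K + 1)) :
    weightEntropy a n ≤ K + 1 := by
  have hm' : (cum a n : ℝ) ≠ 0 := by positivity
  have h : ∀ i ∈ Finset.range n, -((a i / cum a n : ℝ) * Real.logb 2 (a i / cum a n))
      ≤ (a i / cum a n : ℝ) * (K + 1) := by
    intro i _
    rcases Nat.eq_zero_or_pos (a i) with h0 | h0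
    · simp [h0]
    · rw [← mul_neg]
      refine mul_le_mul_of_nonneg_left ?_ (by positivity)
      rw [Real.logb_div (by positivity) hm']
      have h1 := logb_two_natCast_le hm0 hm
      have h2 : 0 ≤ Real.logb 2 (a i) := Real.logb_nonneg (by norm_num) (by exact_mod_cast h0)
      linarith
  rw [weightEntropy, ← Finset.sum_neg_distrib]
  refine (Finset.sum_le_sum h).trans (le_of_eq ?_)
  rw [← Finset.sum_mul, ← Finset.sum_div, sum_weights, div_self hm', one_mul]

lemma entropyBits_eq {p : Fin n → ℝ} (h : ∀ i : Fin n, p i = a i / cum a n) :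
    entropyBits p = weightEntropy a n := by
  rw [weightEntropy, entropyBits, Finset.sum_range, ← Finset.sum_neg_distrib]
  refine Finset.sum_congr rfl fun i _ => ?_
  rw [h, Real.negMulLog, Real.logb]
  ring

lemma memory_sampler_le {K : ℕ} (hn0 : 1 ≤ n) (hm0 : 0 < cum a n) (hn : 16 + n ≤ 2 ^ K)
    (hm : cum a n ≤ 2 ^ K) (ω : ℕ → Bool) (t : ℕ) :
    (sampler a n K).bits + (run (sampler a n K) ω t).dataBits ≤ 456 * (n * (K + 2)) := by
  have h1 := (bits_sampler_le (a := a) hn hm).trans (Nat.mul_le_mul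
    (show 41 + n ≤ 42 * n by omega) (show 2 * K + 20 ≤ 10 * (K + 2) by omega))
  have h2 := ((safe_run hm0 hn hm ω t).dataBits_le hn).trans (Nat.mul_le_mul
    (show 17 + n ≤ 18 * n by omega) (show 2 * K + 3 ≤ 2 * (K + 2) by omega))
  linarith

lemma samples_sampler {K : ℕ} {ε : ℝ} {p : Fin n → ℝ} (hp : p ∈ stdSimplex ℝ (Fin n))
    (h : ∀ i : Fin n, p i = a i / cum a n) (hm0 : 0 < cum a n) (hn : 16 + n ≤ 2 ^ K)
    (hm : cum a n ≤ 2 ^ K) (hloss : SmallLoss (cum a n) K ε) :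
    Samples (sampler a n K) p := by
  refine samples_of_le hp fun T w => ?_
  have := prod_le_measure_outputsWord hm0 hn hm hloss (List.ofFn fun k => (w k : ℕ)) (by
    intro i hi
    obtain ⟨k, rfl⟩ := (List.mem_ofFn' _ _).1 hi
    exact (w k).2)
  rw [List.map_ofFn, List.prod_ofFn] at this
  simpa [h] using this

lemma tossRate_sampler_le {K : ℕ} {ε : ℝ} (hε : 0 ≤ ε) (hm0 : 0 < cum a n)
    (hn : 16 + n ≤ 2 ^ K) (hm : cum a n ≤ 2 ^ K) (hloss : SmallLoss (cum a n) K ε) :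
    tossRate (sampler a n K) ≤ ENNReal.ofReal (weightEntropy a n + ε) := by
  obtain ⟨A, hA, h⟩ := exists_lintegral_costUntil_le 1 0 hm0 hn hm hloss
  have hf : weighted 1 0 = Config.tosses := by
    funext c
    simp [weighted]
  rw [hf] at h
  have hH := weightEntropy_nonneg a n
  refine limsup_div_le (b := K + 1) hA (by positivity) (by positivity) fun T => ?_
  exact (h T).trans (le_of_eq (by simp))

lemma opRate_sampler_le {K : ℕ} {ε : ℝ} (hε : 0 ≤ ε) (hm0 : 0 < cum a n)
    (hn : 16 + n ≤ 2 ^ K) (hm : cum a n ≤ 2 ^ K) (hloss : SmallLoss (cum a n) K ε) :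
    opRate (sampler a n K) ≤
      ENNReal.ofReal ((tossCost K + 5) * (weightEntropy a n + ε) + 2 * divCost K) := by
  obtain ⟨A, hA, h⟩ := exists_lintegral_costUntil_le 0 1 hm0 hn hm hloss
  have hf : weighted 0 1 = Config.ops := by
    funext c
    simp [weighted]
  rw [hf] at h
  have hH := weightEntropy_nonneg a n
  refine limsup_div_le (b := (tossCost K + 5) * (K + 1)) hA (by positivity) (by positivity)
    fun T => ?_
  exact (h T).trans (le_of_eq (by simp))

end

end CoinRAM

open CoinRAM in
theorem theorem1 :
    ∃ C : ℝ, 0 < C ∧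
      ∀ (m n : ℕ) (p : Fin n → ℝ) (ε : ℝ),
        0 < m → n ≤ m →
        p ∈ stdSimplex ℝ (Fin n) →
        (∀ i, ∃ a : ℕ, (m : ℝ) * p i = a) →
        0 < ε → ε ≤ 1 / 2 →
        ∃ P : CoinRAM.Program,
          CoinRAM.Samples P p ∧
          CoinRAM.tossRate P ≤ ENNReal.ofReal (entropyBits p + ε) ∧
          (∀ (ω : ℕ → Bool) (t : ℕ),
            ((P.bits + (CoinRAM.run P ω t).dataBits : ℕ) : ℝ) ≤
              C * ((n + 1 / ε) * Real.log (m / ε))) ∧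
          CoinRAM.opRate P ≤ ENNReal.ofReal (C * (Real.log (m / ε) ^ 2 / ε)) := by
  refine ⟨1000000, by norm_num, fun m n p ε hm0 hnm hp hint hε0 hε => ?_⟩
  choose a' ha' using hint
  set a : ℕ → ℕ := fun j => if h : j < n then a' ⟨j, h⟩ else 0 with ha
  have hm0' : (0 : ℝ) < m := by exact_mod_cast hm0
  have hai : ∀ i : Fin n, (a i : ℝ) = m * p i := fun i => by simp [ha, ha']
  have hcum : cum a n = m := by
    have : (cum a n : ℝ) = m := by
      rw [← sum_weights, Finset.sum_range, Finset.sum_congr rfl fun i _ => hai i,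
        ← Finset.mul_sum, hp.2, mul_one]
    exact_mod_cast this
  have hpa : ∀ i : Fin n, p i = a i / cum a n := fun i => by
    rw [hcum, hai]
    field_simp
  have hn0 : 1 ≤ n := by
    rcases Nat.eq_zero_or_pos n with rfl | h
    · simpa using hp.2
    · exact h
  set X : ℝ := m / ε with hX
  have hX2 : 2 ≤ X := by
    rw [hX, le_div_iff₀ hε0]
    have : (1 : ℝ) ≤ m := by exact_mod_cast hm0
    linarith
  have hXlog : Real.log 2 ≤ Real.log X := Real.log_le_log (by norm_num) hX2
  have hl2 := Real.log_two_gt_d9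
  obtain ⟨L, hL⟩ : ∃ L, L = ⌈Real.logb 2 X⌉₊ := ⟨_, rfl⟩
  have hXL : X ≤ 2 ^ L := by
    have : Real.logb 2 X ≤ L := hL ▸ Nat.le_ceil _
    rwa [Real.logb_le_iff_le_rpow (by norm_num) (by linarith), Real.rpow_natCast] at this
  have hmL : (m : ℝ) ≤ ε * 2 ^ L := by
    rw [hX, div_le_iff₀ hε0] at hXL
    linarith
  have hLlog : (L : ℝ) ≤ 3 * Real.log X := by
    have h1 : (L : ℝ) < Real.logb 2 X + 1 :=
      hL ▸ Nat.ceil_lt_add_one (Real.logb_nonneg (by norm_num) (by linarith))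
    have h2 : Real.logb 2 X + 1 ≤ 3 * Real.log X := by
      rw [Real.logb, div_add_one (by linarith), div_le_iff₀ (by linarith)]
      nlinarith
    linarith
  set K := 2 * L + 10 with hK
  have hKlog : (K : ℝ) + 2 ≤ 24 * Real.log X := by
    rw [hK]
    push_cast
    linarith
  have hm2 : m ≤ 2 ^ L := by
    have : (m : ℝ) ≤ 2 ^ L := by
      have : ε * 2 ^ L ≤ 1 * 2 ^ L := mul_le_mul_of_nonneg_right (by linarith) (by positivity)
      linarith
    exact_mod_cast this
  have hpow : 2 ^ K = 1024 * (2 ^ L * 2 ^ L) := by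
    rw [hK]
    ring
  have hpos : 1 ≤ 2 ^ L := Nat.one_le_two_pow
  have hsq : 2 ^ L ≤ 2 ^ L * 2 ^ L := Nat.le_mul_of_pos_left _ hpos
  have hmK : m ≤ 2 ^ K := by omega
  have hnK : 16 + n ≤ 2 ^ K := by omega
  have hloss : SmallLoss m K ε := smallLoss_of_le hm0 (by linarith) hmL
  have hlog0 : 0 ≤ Real.log X := by linarith
  rw [← hcum] at hm0 hmK hloss
  refine ⟨sampler a n K, samples_sampler hp hpa hm0 hnK hmK hloss, ?_, fun ω t => ?_, ?_⟩
  · rw [entropyBits_eq hpa]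
    exact tossRate_sampler_le hε0.le hm0 hnK hmK hloss
  · have h3 := memory_sampler_le hn0 hm0 hnK hmK ω t
    have h4 : (((sampler a n K).bits + (run (sampler a n K) ω t).dataBits : ℕ) : ℝ)
        ≤ 456 * (n * (K + 2)) := by exact_mod_cast h3
    have h5 : (n : ℝ) * (K + 2) ≤ n * (24 * Real.log X) :=
      mul_le_mul_of_nonneg_left hKlog (by positivity)
    have h6 : 0 ≤ 1 / ε * Real.log X := by positivity
    have h7 : 0 ≤ (n : ℝ) * Real.log X := by positivity
    linarith
  · refine (opRate_sampler_le hε0.le hm0 hnK hmK hloss).trans (ENNReal.ofReal_le_ofReal ?_)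
    have hH := weightEntropy_le (K := K) hm0 (by rw [pow_succ]; omega)
    have hH0 := weightEntropy_nonneg a n
    set u : ℝ := K + 2 with hu
    have hu2 : 2 ≤ u := by rw [hu]; linarith [(Nat.cast_nonneg K : (0 : ℝ) ≤ K)]
    have h1 : ((tossCost K : ℝ) + 5) * (weightEntropy a n + ε) ≤ (150 * u) * u := by
      refine mul_le_mul ?_ (by linarith) (by positivity) (by positivity)
      rw [tossCost]
      push_cast
      linarith
    have h2 : (divCost K : ℝ) ≤ 305 * (u * u) := by
      have h3 : (8 * (K : ℝ) + 19) * (40 + 4 * u) ≤ (10 * u) * (24 * u) := by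
        refine mul_le_mul ?_ (by linarith) (by positivity) (by positivity)
        linarith
      have h4 : 2 * u ≤ u * u := mul_le_mul_of_nonneg_right hu2 (by linarith)
      rw [divCost]
      push_cast
      rw [← hu]
      linarith
    have h3 : u * u ≤ (24 * Real.log X) * (24 * Real.log X) :=
      mul_le_mul hKlog hKlog (by linarith) (by linarith)
    have h4 : Real.log X ^ 2 ≤ Real.log X ^ 2 / ε :=
      le_div_self (by positivity) hε0 (by linarith)
    have h5 : 0 ≤ Real.log X ^ 2 := by positivity
    linarith
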